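/- Let $F$ be a $k$-CNF formula with $n$ variables and $m$ clauses, i.e. a list of $m$ clauses, each a disjunction of $k$ literals on $k$ distinct variables, and let $C$ be a set of clauses of $F$ (the core); $\overline C$ denotes the set of the other clauses of $F$. Let $\gamma\ge 0$ and suppose that (i) every clause in $C$ shares variables with at most $2^k/e-1$ other clauses in $C$, and (ii) every clause in $\overline C$ shares variables with at most $\gamma\,(2^k/e-1)$ clauses in $C$. Then the following hold, where the algorithms are given $F$ and $C$ (but not $\gamma$), run on a random access machine with fair coin flips, and obey the stated time bound in the worst case, for all outcomes of the coin flips. (a) For every polynomial $q$ and every constant $c$ there is a randomized algorithm that runs in time polynomial in $n$ and $m$ and that, for every real $\theta>0$ with $\theta\, q(n+m)\ge 1$, with probability at least $1-(n+m+1)^{-c}$ produces an assignment that satisfies all clauses in $C$ and violates at most $(1+\theta)\,2^{-k}e^{\gamma}\,|\overline C|$ of the clauses in $\overline C$. (b) For every constant $c$ there is a randomized algorithm that runs in time polynomial in $n$ and $|C|$ and that, for every real $\rho>0$, with probability at least $1-\rho-(n+|C|+1)^{-c}$ produces an assignment that satisfies all clauses in $C$ and violates at most $\frac1\rho\,2^{-k}e^{\gamma}\,|\overline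 C|$ of the clauses in $\overline C$. -/

import Mathlib

open MeasureTheory

/-! ## `k`-CNF formulas -/

/-- A clause of width exactly `k` over the variables `Fin n`: a disjunction of `k` literals on
`k` distinct variables. The `a`-th literal is the variable `var a`, unnegated iff `sign a = true`. -/
structure Clause (n k : ℕ) where
  var : Fin k ↪ Fin n
  sign : Fin k → Bool

/-- The assignment `σ` satisfies the clause: some literal is true. -/
def Clause.Satisfied {n k : ℕ} (c : Clause n k) (σ : Fin n → Bool) : Prop :=
  ∃ a : Fin k, σ (c.var a) = c.sign a

instance {n k : ℕ} (c : Clause n k) (σ : Fin n → Bool) : Decidable (c.Satisfied σ) :=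
  inferInstanceAs (Decidable (∃ a : Fin k, σ (c.var a) = c.sign a))

/-- Two clauses share a variable (with any signs). -/
def Clause.SharesVar {n k : ℕ} (c c' : Clause n k) : Prop :=
  ∃ a b : Fin k, c.var a = c'.var b

instance {n k : ℕ} (c c' : Clause n k) : Decidable (c.SharesVar c') :=
  inferInstanceAs (Decidable (∃ a b : Fin k, c.var a = c'.var b))

/-- A `k`-CNF formula with `n` variables and `m` clauses (a list of clauses, so repetitions are
allowed and are counted as different clauses). -/
abbrev Formula (n m k : ℕ) : Type := Fin m → Clause n k

/-- The number of clauses of `C`, other than the clause `j` itself, that share a variable with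
the clause `j`. -/
def Formula.coreDegree {n m k : ℕ} (F : Formula n m k) (C : Finset (Fin m)) (j : Fin m) : ℕ :=
  (C.filter fun i => i ≠ j ∧ (F i).SharesVar (F j)).card

/-- The number of clauses outside `C` that `σ` violates. -/
def Formula.violatedOutside {n m k : ℕ} (F : Formula n m k) (C : Finset (Fin m))
    (σ : Fin n → Bool) : ℕ :=
  (Cᶜ.filter fun j => ¬ (F j).Satisfied σ).card

/-! ## Randomized random access machines

A structured random access machine over the natural numbers with fair coin flips and unit cost
per step. Values can grow only through addition and programs are fixed finite objects, so `t`
steps from an input of `b`-bit numbers only produce numbers of `O(b + t)` bits, and polynomial time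
on this machine is polynomial time on a probabilistic Turing machine. -/

namespace RandRAM

/-- Expressions: constants, registers, memory cells, addition, truncated subtraction and the
comparisons `<` and `=` (with value `1` or `0`). -/
inductive Expr where
  | const (c : ℕ)
  | reg (x : ℕ)
  | load (a i : Expr)
  | add (e f : Expr)
  | sub (e f : Expr)
  | lt (e f : Expr)
  | eq (e f : Expr)

/-- Programs. -/
inductive Prog where
  | skip
  | set (x : ℕ) (e : Expr)
  | store (a i e : Expr)
  | flip (x : ℕ)
  | seq (p q : Prog)
  | ite (e : Expr) (p q : Prog)
  | while (e : Expr) (p : Prog)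

/-- The machine's store: registers, and a memory of arrays (`mem a i` is entry `i` of array `a`). -/
structure Store where
  reg : ℕ → ℕ
  mem : ℕ → ℕ → ℕ

/-- The value of an expression. -/
def Expr.eval (s : Store) : Expr → ℕ
  | .const c => c
  | .reg x => s.reg x
  | .load a i => s.mem (a.eval s) (i.eval s)
  | .add e f => e.eval s + f.eval s
  | .sub e f => e.eval s - f.eval s
  | .lt e f => if e.eval s < f.eval s then 1 else 0
  | .eq e f => if e.eval s = f.eval s then 1 else 0

/-- Write a register. -/
def Store.setReg (s : Store) (x v : ℕ) : Store :=
  { s with reg := Function.update s.reg x v }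

/-- Write a memory cell. -/
def Store.setMem (s : Store) (a i v : ℕ) : Store :=
  { s with mem := Function.update s.mem a (Function.update (s.mem a) i v) }

/-- A configuration: the stack of programs that remain to be run, the store, and the coins that
have not been used yet. -/
structure Config where
  todo : List Prog
  store : Store
  coins : ℕ → Bool

/-- One step of the machine. A configuration with nothing left to run has halted and does not
change any more. -/
def step : Config → Config
  | ⟨[], s, ω⟩ => ⟨[], s, ω⟩
  | ⟨.skip :: K, s, ω⟩ => ⟨K, s, ω⟩
  | ⟨.set x e :: K, s, ω⟩ => ⟨K, s.setReg x (e.eval s), ω⟩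
  | ⟨.store a i e :: K, s, ω⟩ => ⟨K, s.setMem (a.eval s) (i.eval s) (e.eval s), ω⟩
  | ⟨.flip x :: K, s, ω⟩ => ⟨K, s.setReg x (ω 0).toNat, fun t => ω (t + 1)⟩
  | ⟨.seq p q :: K, s, ω⟩ => ⟨p :: q :: K, s, ω⟩
  | ⟨.ite e p q :: K, s, ω⟩ => ⟨(if e.eval s ≠ 0 then p else q) :: K, s, ω⟩
  | ⟨.while e p :: K, s, ω⟩ =>
      ⟨if e.eval s ≠ 0 then p :: .while e p :: K else K, s, ω⟩

/-- The configuration after `t` steps of the program `P` on the initial store `s` with the coin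
sequence `ω`. -/
def run (P : Prog) (s : Store) (ω : ℕ → Bool) (t : ℕ) : Config :=
  step^[t] ⟨[P], s, ω⟩

/-- On the initial store `s`, the program halts within `t` steps, whatever the coins are. -/
def HaltsWithin (P : Prog) (s : Store) (t : ℕ) : Prop :=
  ∀ ω : ℕ → Bool, (run P s ω t).todo = []

/-- An infinite sequence of independent fair coins. -/
noncomputable def coinMeasure : Measure (ℕ → Bool) :=
  Measure.infinitePi fun _ => (PMF.uniformOfFintype Bool).toMeasure

/-- The initial store for a formula `F` with a distinguished set of clauses `C`.
Registers `0, 1, 2, 3` hold `n`, `m`, `k`, `|C|`. Array `1` lists the indices of the clauses in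
`C` in increasing order. Arrays `2 j + 2` and `2 j + 3` hold the variables and the signs of the
literals of the clause `j`. Everything else is `0`. -/
def input {n m k : ℕ} (F : Formula n m k) (C : Finset (Fin m)) : Store where
  reg x := if x = 0 then n else if x = 1 then m else if x = 2 then k
    else if x = 3 then C.card else 0
  mem a i :=
    if a = 1 then ((C.sort (· ≤ ·)).map Fin.val).getD i 0
    else if h : 2 ≤ a ∧ (a - 2) / 2 < m ∧ i < k then
      let c := F ⟨(a - 2) / 2, h.2.1⟩
      if a % 2 = 0 then (c.var ⟨i, h.2.2⟩ : ℕ) else (c.sign ⟨i, h.2.2⟩).toNat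
    else 0

/-- The assignment that a store holds in array `0` (nonzero means true). -/
def Store.assignment (s : Store) (n : ℕ) : Fin n → Bool :=
  fun v => decide (s.mem 0 v ≠ 0)

/-- The assignment that the program `P`, on the formula `F` with distinguished clauses `C` and
with coins `ω`, has produced after `t` steps. -/
def output {n m k : ℕ} (P : Prog) (F : Formula n m k) (C : Finset (Fin m)) (t : ℕ)
    (ω : ℕ → Bool) : Fin n → Bool :=
  (run P (input F C) ω t).store.assignment n

end RandRAM

/-! Both algorithms run the Moser–Tardos process on the core: start from a uniform assignment and,
while a core clause is violated, draw fresh values for its variables. Put `w = e 2⁻ᵏ`. For every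
clause `D`, in the core or not, and at every time, `D` is violated with probability at most `2⁻ᵏ (1
+ w) ^ d`, where `d` counts the core clauses equal to `D` or sharing a variable with it. In the core
`d ≤ 1 / w`, which gives at most `w`; outside `d ≤ γ (1 / w - 1)`, which gives at most `2⁻ᵏ e^γ`.

The bound comes from a potential, by induction on the number of remaining steps. A heap has `D` on
top, and each further layer consists of core events linked to the layer before; deeper layers stand
for earlier resamplings. Its weight at `σ` is `2⁻ᵏ` to the number of its events, times the density
at `σ` of the uniform distribution on the assignments with the values the heap prescribes, the
deepest event on a variable deciding. If a violated `c` is resampled, the expected weight of a heap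
afterwards is the weight beforehand of the heap with `c` pushed in at the bottom
(`mean_heapDensity_resample`), and pushing is injective (`push_injective`). So the sum over all
heaps dominates the probability that `D` is violated later (`mean_agrees_process_le`). The heap
`{D}` alone is never a push of `D`; it pays for resampling `D` (`mean_potential_resample`), which
bounds the expected number of resamplings (`mean_alive_process_le`). At a uniform start every
density averages to `1`, and the sum of the remaining powers is estimated layer by layer
(`sum_pow_size_le`).

Two Markov bounds show that a trial of `N` steps fails with probability at most `1 / a + |C| / N`
for the factor `a` (`mean_not_good_le`). Part (b) is one trial with `a = 1 / ρ`. For (a), `a = 1 +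
θ` leaves an inverse polynomial chance of success, and the best of polynomially many independent
trials is returned, which requires knowing neither `γ` nor `θ`. -/

/-! ## Expectations over finitely many coins -/

namespace Coins

/-- Prepend a coin. -/
def cons (b : Bool) (ω : ℕ → Bool) : ℕ → Bool
  | 0 => b
  | t + 1 => ω t

/-- Drop the first `d` coins. -/
def drop (d : ℕ) (ω : ℕ → Bool) : ℕ → Bool := fun i => ω (i + d)

/-- The first `a` coins of `ω`, followed by `ω'`. -/
def append (a : ℕ) (ω ω' : ℕ → Bool) : ℕ → Bool :=
  fun i => if i < a then ω i else ω' (i - a)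

/-- The expectation of `f` when the first `L` coins are fair (and the others are `false`). -/
noncomputable def mean : ℕ → ((ℕ → Bool) → ℝ) → ℝ
  | 0, f => f fun _ => false
  | L + 1, f => (mean L (fun ω => f (cons false ω)) + mean L (fun ω => f (cons true ω))) / 2

lemma drop_zero (ω : ℕ → Bool) : drop 0 ω = ω := rfl

lemma drop_drop (a b : ℕ) (ω : ℕ → Bool) : drop b (drop a ω) = drop (a + b) ω := by
  funext i; simp only [drop]; congr 1; omega

lemma drop_append (a : ℕ) (ω ω' : ℕ → Bool) : drop a (append a ω ω') = ω' := by
  funext i; simp [drop, append]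

lemma append_apply_of_lt {a i : ℕ} (h : i < a) (ω ω' : ℕ → Bool) : append a ω ω' i = ω i := by
  simp [append, h]

lemma append_cons (a : ℕ) (b : Bool) (ω ω' : ℕ → Bool) :
    append (a + 1) (cons b ω) ω' = cons b (append a ω ω') := by
  funext i
  cases i with
  | zero => simp [append, cons]
  | succ i => simp [append, cons]

lemma mean_mono (L : ℕ) {f g : (ℕ → Bool) → ℝ} (h : ∀ ω, f ω ≤ g ω) : mean L f ≤ mean L g := by
  induction L generalizing f g with
  | zero => exact h _
  | succ L ih =>
    simp only [mean]
    have h1 := ih (fun ω => h (cons false ω))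
    have h2 := ih (fun ω => h (cons true ω))
    linarith

lemma mean_const (L : ℕ) (a : ℝ) : mean L (fun _ => a) = a := by
  induction L with
  | zero => rfl
  | succ L ih => simp [mean, ih]

lemma mean_add (L : ℕ) (f g : (ℕ → Bool) → ℝ) :
    mean L (fun ω => f ω + g ω) = mean L f + mean L g := by
  induction L generalizing f g with
  | zero => rfl
  | succ L ih => simp only [mean, ih]; ring

lemma mean_const_mul (L : ℕ) (a : ℝ) (f : (ℕ → Bool) → ℝ) :
    mean L (fun ω => a * f ω) = a * mean L f := by
  induction L generalizing f with
  | zero => rfl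
  | succ L ih => simp only [mean, ih]; ring

lemma mean_sum {ι : Type*} (L : ℕ) (S : Finset ι) (f : ι → (ℕ → Bool) → ℝ) :
    mean L (fun ω => ∑ i ∈ S, f i ω) = ∑ i ∈ S, mean L (f i) := by
  classical
  induction S using Finset.induction_on with
  | empty => simp [mean_const]
  | insert a S ha ih => simp only [Finset.sum_insert ha, mean_add, ih]

lemma mean_add_coins (a b : ℕ) (f : (ℕ → Bool) → ℝ) :
    mean (a + b) f = mean a fun ω => mean b fun ω' => f (append a ω ω') := by
  induction a generalizing f with
  | zero =>
    rw [Nat.zero_add]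
    simp only [mean]
    congr 1
  | succ a ih =>
    rw [Nat.succ_add]
    simp only [mean, ih, append_cons]

lemma mean_prod (n : ℕ) (h : Fin n → Bool → ℝ) :
    mean n (fun ω => ∏ x : Fin n, h x (ω x)) = ∏ x, (h x false + h x true) / 2 := by
  induction n with
  | zero => simp [mean]
  | succ n ih =>
    simp only [mean, Fin.prod_univ_succ, Fin.val_zero, Fin.val_succ, cons, mean_const_mul, ih]
    ring

/-- Disjoint blocks of coins are independent; this is what makes repeated trials amplify. -/
lemma mean_prod_drop {d : ℕ} {g : (ℕ → Bool) → ℝ}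
    (hg : ∀ ω ω', (∀ i < d, ω i = ω' i) → g ω = g ω') (R : ℕ) :
    mean (R * d) (fun ω => ∏ r ∈ Finset.range R, g (drop (r * d) ω)) = mean d g ^ R := by
  induction R with
  | zero => simp [mean_const]
  | succ R ih =>
    rw [Nat.succ_mul, Nat.add_comm, mean_add_coins]
    have h1 : ∀ ω ω', ∏ r ∈ Finset.range (R + 1), g (drop (r * d) (append d ω ω')) =
        g ω * ∏ r ∈ Finset.range R, g (drop (r * d) ω') := by
      intro ω ω'
      rw [Finset.prod_range_succ', mul_comm]
      congr 1
      · rw [zero_mul, drop_zero]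
        exact hg _ _ fun i hi => append_apply_of_lt hi _ _
      · refine Finset.prod_congr rfl fun r _ => ?_
        rw [Nat.succ_mul, Nat.add_comm, ← drop_drop, drop_append]
    simp_rw [h1, mean_const_mul, ih, mul_comm _ (mean d g ^ R)]
    rw [mean_const_mul, pow_succ]

lemma mean_indicator_compl (L : ℕ) (S : Set (ℕ → Bool)) :
    mean L (S.indicator 1) = 1 - mean L (Sᶜ.indicator 1) := by
  have h : mean L (fun ω => S.indicator 1 ω + Sᶜ.indicator 1 ω) = 1 := by
    simp only [Set.indicator_self_add_compl_apply, Pi.one_apply, mean_const]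
  rw [mean_add] at h
  change mean L (S.indicator 1) + mean L (Sᶜ.indicator 1) = 1 at h
  linarith

lemma map_cons :
    ((PMF.uniformOfFintype Bool).toMeasure.prod RandRAM.coinMeasure).map
      (fun x => cons x.1 x.2) = RandRAM.coinMeasure := by
  have hm : Measurable fun x : Bool × (ℕ → Bool) => cons x.1 x.2 := by
    refine measurable_pi_lambda _ fun i => ?_
    cases i with
    | zero => exact measurable_fst
    | succ i => exact (measurable_pi_apply i).comp measurable_snd
  unfold RandRAM.coinMeasure
  refine Measure.eq_infinitePi _ fun S t ht => ?_
  classical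
  -- The cylinder is padded with full factors to an initial segment, so that coordinate `0` splits
  -- off as the prepended coin.
  obtain ⟨N, hN⟩ : ∃ N, S ⊆ Finset.range (N + 1) :=
    ⟨S.sup id, fun i hi => Finset.mem_range.2 (Nat.lt_succ_of_le (Finset.le_sup (f := id) hi))⟩
  set t' : ℕ → Set Bool := fun i => if i ∈ S then t i else Set.univ with ht'
  have hpi : Set.pi (S : Set ℕ) t = Set.pi (Finset.range (N + 1) : Set ℕ) t' := by
    ext ω
    simp only [Set.mem_pi, Finset.mem_coe, ht']
    constructor
    · intro h i _
      split_ifs with hi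
      · exact h i hi
      · trivial
    · intro h i hi
      simpa [hi] using h i (hN hi)
  have hprod : ∏ i ∈ S, (PMF.uniformOfFintype Bool).toMeasure (t i) =
      ∏ i ∈ Finset.range (N + 1), (PMF.uniformOfFintype Bool).toMeasure (t' i) := by
    rw [← Finset.prod_subset hN]
    · exact Finset.prod_congr rfl fun i hi => by simp [ht', hi]
    · intro i _ hi
      simp only [ht', if_neg hi]
      exact measure_univ
  have hmt : ∀ i, MeasurableSet (t' i) := fun i => MeasurableSet.of_discrete
  have hpre : (fun x : Bool × (ℕ → Bool) => cons x.1 x.2) ⁻¹'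
      Set.pi (Finset.range (N + 1) : Set ℕ) t' =
      t' 0 ×ˢ Set.pi (Finset.range N : Set ℕ) fun i => t' (i + 1) := by
    ext ⟨b, ω⟩
    simp only [Set.mem_preimage, Set.mem_pi, Finset.coe_range, Set.mem_Iio, Set.mem_prod]
    constructor
    · intro h
      exact ⟨h 0 (by omega), fun i hi => h (i + 1) (by omega)⟩
    · rintro ⟨h0, h⟩ i hi
      cases i with
      | zero => exact h0
      | succ i => exact h i (by omega)
  rw [hpi, hprod, Measure.map_apply hm
    (MeasurableSet.pi (Finset.countable_toSet _) fun i _ => hmt i), hpre, Measure.prod_prod,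
    Measure.infinitePi_pi _ fun i _ => hmt (i + 1), Finset.prod_range_succ', mul_comm]

instance : IsProbabilityMeasure RandRAM.coinMeasure := by
  unfold RandRAM.coinMeasure
  infer_instance

lemma measurable_cons (b : Bool) : Measurable (cons b) := by
  refine measurable_pi_lambda _ fun i => ?_
  cases i with
  | zero => exact measurable_const
  | succ i => exact measurable_pi_apply i

lemma coinMeasure_eq_add {S : Set (ℕ → Bool)} (hS : MeasurableSet S) :
    RandRAM.coinMeasure.real S = (RandRAM.coinMeasure.real (cons false ⁻¹' S) +
      RandRAM.coinMeasure.real (cons true ⁻¹' S)) / 2 := by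
  have hm : Measurable fun x : Bool × (ℕ → Bool) => cons x.1 x.2 :=
    measurable_from_prod_countable_right fun b => measurable_cons b
  have h : RandRAM.coinMeasure S = (2 : ENNReal)⁻¹ * RandRAM.coinMeasure (cons false ⁻¹' S) +
      (2 : ENNReal)⁻¹ * RandRAM.coinMeasure (cons true ⁻¹' S) := by
    conv_lhs => rw [← map_cons]
    rw [Measure.map_apply hm hS, Measure.prod_apply (hm hS), lintegral_fintype]
    simp only [Fintype.univ_bool, Finset.mem_singleton, Bool.true_eq_false, not_false_eq_true,
      Finset.sum_insert, Finset.sum_singleton, PMF.toMeasure_apply_singleton _ _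
        (MeasurableSet.singleton _), PMF.uniformOfFintype_apply, Fintype.card_bool]
    rw [add_comm, mul_comm, mul_comm (RandRAM.coinMeasure _)]
    rfl
  have e := congrArg ENNReal.toReal h
  rw [ENNReal.toReal_add (by finiteness) (by finiteness), ENNReal.toReal_mul,
    ENNReal.toReal_mul] at e
  simp only [Measure.real, e, ENNReal.toReal_inv, ENNReal.toReal_ofNat]
  ring

/-- `S` depends on the first `L` coins only. -/
def DependsOnFirst (L : ℕ) (S : Set (ℕ → Bool)) : Prop :=
  ∀ ω ω' : ℕ → Bool, (∀ i < L, ω i = ω' i) → (ω ∈ S ↔ ω' ∈ S)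

lemma DependsOnFirst.preimage_cons {L : ℕ} {S : Set (ℕ → Bool)} (h : DependsOnFirst (L + 1) S)
    (b : Bool) : DependsOnFirst L (cons b ⁻¹' S) := by
  intro ω ω' hω
  refine h _ _ fun i hi => ?_
  cases i with
  | zero => rfl
  | succ i => exact hω i (by omega)

lemma DependsOnFirst.measurableSet {L : ℕ} {S : Set (ℕ → Bool)} (h : DependsOnFirst L S) :
    MeasurableSet S := by
  have hm : Measurable fun (ω : ℕ → Bool) (i : Fin L) => ω i :=
    measurable_pi_lambda _ fun i => measurable_pi_apply _
  have : S = (fun (ω : ℕ → Bool) (i : Fin L) => ω i) ⁻¹'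
      {x | (fun i => if hi : i < L then x ⟨i, hi⟩ else false) ∈ S} := by
    ext ω
    exact h _ _ fun i hi => by simp [hi]
  rw [this]
  exact hm MeasurableSet.of_discrete

/-- The bridge from the infinite product measure to finite averages: both satisfy the same recursion
on the first coin, and the padding by `false` is invisible to `S`. -/
lemma coinMeasure_eq_mean {L : ℕ} {S : Set (ℕ → Bool)} (h : DependsOnFirst L S) :
    RandRAM.coinMeasure.real S = mean L (S.indicator 1) := by
  induction L generalizing S with
  | zero =>
    by_cases hS : (fun _ => false) ∈ S
    · have : S = Set.univ := Set.eq_univ_of_forall fun ω =>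
        (h _ _ fun i hi => absurd hi (by omega)).1 hS
      simp [this, mean]
    · have : S = ∅ := Set.eq_empty_of_forall_notMem fun ω hω =>
        hS ((h ω _ fun i hi => absurd hi (by omega)).1 hω)
      simp [this, mean]
  | succ L ih =>
    rw [coinMeasure_eq_add h.measurableSet, ih (h.preimage_cons false),
      ih (h.preimage_cons true)]
    rfl

end Coins

/-! ## The Moser–Tardos process -/

namespace MoserTardos

set_option linter.unusedSectionVars false

open Coins

/-! ### Densities of partial assignments under resampling -/

section Density

variable {n : ℕ}

/-- The assignment agrees with the partial assignment `r`. -/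
def Agrees (r : Fin n → Option Bool) (σ : Fin n → Bool) : Prop :=
  ∀ x b, r x = some b → σ x = b

/-- The domain of a partial assignment. -/
def dom (r : Fin n → Option Bool) : Finset (Fin n) :=
  Finset.univ.filter fun x => (r x).isSome

/-- The density, with respect to the uniform distribution, of the uniform distribution on the
assignments that agree with `r`. -/
noncomputable def density (r : Fin n → Option Bool) (σ : Fin n → Bool) : ℝ :=
  ∏ x, (r x).elim 1 fun b => if σ x = b then 2 else 0

/-- Replace the values on the domain of `r` by coins. -/
def resample (r : Fin n → Option Bool) (σ : Fin n → Bool) (ω : ℕ → Bool) : Fin n → Bool :=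
  fun x => if (r x).isSome then ω x else σ x

/-- The partial assignment `r₁`, extended by `r₂`. -/
def override (r₁ r₂ : Fin n → Option Bool) : Fin n → Option Bool := fun x => (r₁ x).or (r₂ x)

lemma density_nonneg (r : Fin n → Option Bool) (σ : Fin n → Bool) : 0 ≤ density r σ := by
  refine Finset.prod_nonneg fun x _ => ?_
  cases r x with
  | none => simp
  | some b => simp only [Option.elim]; split_ifs <;> norm_num

lemma mean_density (r : Fin n → Option Bool) :
    mean n (fun ω => density r fun x => ω x) = 1 := by
  unfold density
  rw [mean_prod n fun x c => (r x).elim 1 fun b => if c = b then 2 else 0]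
  refine Finset.prod_eq_one fun x _ => ?_
  cases r x with
  | none => simp
  | some b => cases b <;> simp

/-- Coordinatewise: on the domain of `r` the fresh coin averages the factor of `r'` to `1`, while
the factor of `override r r'` is `2` because `σ` agrees with `r`. Other coordinates are untouched.
-/
lemma mean_density_resample {r : Fin n → Option Bool} {σ : Fin n → Bool} (h : Agrees r σ)
    (r' : Fin n → Option Bool) :
    mean n (fun ω => density r' (resample r σ ω)) =
      (1 / 2) ^ (dom r).card * density (override r r') σ := by
  unfold density resample
  rw [mean_prod n fun x c => (r' x).elim 1 fun b =>
    if (if (r x).isSome then c else σ x) = b then 2 else 0]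
  rw [← Finset.prod_const, dom, Finset.prod_filter, ← Finset.prod_mul_distrib]
  refine Finset.prod_congr rfl fun x _ => ?_
  cases hr : r x with
  | none => cases hr' : r' x <;> simp [override, hr, hr']
  | some b =>
    have := h x b hr
    cases hr' : r' x with
    | none => simp [override, hr, this]
    | some b' => cases b' <;> simp [override, hr, this]

lemma density_resample_of_disjoint {r r' : Fin n → Option Bool}
    (h : ∀ x, (r x).isSome → r' x = none) (σ : Fin n → Bool) (ω : ℕ → Bool) :
    density r' (resample r σ ω) = density r' σ := by
  refine Finset.prod_congr rfl fun x _ => ?_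
  unfold resample
  split_ifs with hx
  · rw [h x hx]; rfl
  · rfl

lemma density_of_agrees {r : Fin n → Option Bool} {σ : Fin n → Bool} (h : Agrees r σ) :
    density r σ = 2 ^ (dom r).card := by
  unfold density
  rw [← Finset.prod_const, dom, Finset.prod_filter]
  refine Finset.prod_congr rfl fun x _ => ?_
  cases hr : r x with
  | none => simp
  | some b => simp [h x b hr]

end Density

/-! ### Heaps of core events and their potential -/

section Heaps

variable {n : ℕ} {ι : Type*} [DecidableEq ι] (β : ι → Fin n → Option Bool)
  (C : Finset ι)

/-- The events `c` and `c'` are equal or share a variable. -/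
def Adj (c c' : ι) : Prop := c = c' ∨ ∃ x, (β c x).isSome ∧ (β c' x).isSome

/-- Some member of `S` is equal to `c` or shares a variable with `c`. -/
def Linked (S : Finset ι) (c : ι) : Prop := ∃ c' ∈ S, Adj β c' c

open Classical in
/-- The core events that are linked to `S`. -/
noncomputable def nbhd (S : Finset ι) : Finset ι := C.filter (Linked β S)

lemma mem_nbhd {S : Finset ι} {c : ι} : c ∈ nbhd β C S ↔ c ∈ C ∧ Linked β S c := by
  simp [nbhd]

/-- The values that the events in a layer prescribe. -/
noncomputable def layerValue (S : Finset ι) (x : Fin n) : Option Bool :=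
  open Classical in
  if ∃ c ∈ S, (β c x).isSome then some (decide (∃ c ∈ S, β c x = some true)) else none

/-- The values that the first `r` layers prescribe; a later layer has priority. -/
noncomputable def prescribed (L : ℕ → Finset ι) : ℕ → Fin n → Option Bool
  | 0 => fun _ => none
  | i + 1 => override (layerValue β (L i)) (prescribed L i)

/-- The number of events in the layers `0, …, r`. -/
def size (r : ℕ) (L : ℕ → Finset ι) : ℕ := ∑ i ∈ Finset.range (r + 1), (L i).card

/-- Put a layer on top. -/
def consLayer (S : Finset ι) (L : ℕ → Finset ι) : ℕ → Finset ι
  | 0 => S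
  | i + 1 => L i

open Classical in
/-- The heaps of depth at most `r` with top layer `S`: layer `i + 1` consists of core events linked
to layer `i`. -/
noncomputable def heaps : ℕ → Finset ι → Finset (ℕ → Finset ι)
  | 0, S => {consLayer S fun _ => ∅}
  | r + 1, S => (nbhd β C S).powerset.biUnion fun S' => (heaps r S').image (consLayer S)

/-- Events within a layer may share variables. Admitting such heaps only adds nonnegative terms to
the potential, and it lets the next layer range over all subsets of a neighbourhood. -/
lemma mem_heaps {r : ℕ} {S : Finset ι} {L : ℕ → Finset ι} :
    L ∈ heaps β C r S ↔
      L 0 = S ∧ (∀ i, L (i + 1) ⊆ nbhd β C (L i)) ∧ ∀ i, r < i → L i = ∅ := by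
  induction r generalizing S L with
  | zero =>
    simp only [heaps, Finset.mem_singleton]
    constructor
    · rintro rfl
      refine ⟨rfl, fun i => by simp [consLayer], fun i hi => ?_⟩
      cases i with
      | zero => omega
      | succ i => rfl
    · rintro ⟨h0, -, h⟩
      funext i
      cases i with
      | zero => exact h0
      | succ i => exact h _ (by omega)
  | succ r ih =>
    simp only [heaps, Finset.mem_biUnion, Finset.mem_powerset, Finset.mem_image]
    constructor
    · rintro ⟨S', hS', L', hL', rfl⟩
      obtain ⟨h0, h1, h2⟩ := ih.1 hL'
      refine ⟨rfl, fun i => ?_, fun i hi => ?_⟩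
      · cases i with
        | zero => simpa [consLayer, h0] using hS'
        | succ i => exact h1 i
      · cases i with
        | zero => omega
        | succ i => exact h2 i (by omega)
    · rintro ⟨h0, h1, h2⟩
      refine ⟨L 1, h0 ▸ h1 0, fun i => L (i + 1), ih.2 ⟨rfl, fun i => h1 _,
        fun i hi => h2 _ (by omega)⟩, ?_⟩
      funext i
      cases i with
      | zero => exact h0.symm
      | succ i => rfl

lemma heaps_subset_succ (r : ℕ) (S : Finset ι) : heaps β C r S ⊆ heaps β C (r + 1) S := by
  intro L hL
  rw [mem_heaps] at hL ⊢
  exact ⟨hL.1, hL.2.1, fun i hi => hL.2.2 i (by omega)⟩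

open Classical in
/-- The layer of a heap of depth at most `r` in which `c` has to be inserted at the bottom. -/
noncomputable def level (c : ι) (r : ℕ) (L : ℕ → Finset ι) : ℕ :=
  Nat.findGreatest (fun i => Linked β (L i) c) r + 1

open Classical in
/-- Insert `c` at the bottom of a heap, if it is linked to the heap. -/
noncomputable def push (c : ι) (r : ℕ) (L : ℕ → Finset ι) : ℕ → Finset ι :=
  if ∃ i ≤ r, Linked β (L i) c then
    Function.update L (level β c r L) (insert c (L (level β c r L)))
  else L

/-- The weighted density of a heap. -/
noncomputable def heapDensity (p : ℝ) (r : ℕ) (L : ℕ → Finset ι) (σ : Fin n → Bool) : ℝ :=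
  p ^ size r L * density (prescribed β L (r + 1)) σ

/-- The sum of the weighted densities of the heaps of depth at most `r` with top `D`. -/
noncomputable def potential (p : ℝ) (r : ℕ) (D : ι) (σ : Fin n → Bool) : ℝ :=
  ∑ L ∈ heaps β C r {D}, heapDensity β p r L σ

variable {β C}

lemma linked_of_mem {S : Finset ι} {c : ι} (h : c ∈ S) : Linked β S c := ⟨c, h, Or.inl rfl⟩

lemma not_linked_empty (c : ι) : ¬ Linked β (∅ : Finset ι) c := by simp [Linked]

/-! ### Pushing an event in at the bottom of a heap -/

section Push

variable {r : ℕ} {L : ℕ → Finset ι} {c : ι}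

lemma level_le (c : ι) (r : ℕ) (L : ℕ → Finset ι) : level β c r L ≤ r + 1 := by
  classical
  exact Nat.succ_le_succ (Nat.findGreatest_le r)

lemma level_spec (h : ∃ i ≤ r, Linked β (L i) c) :
    ∃ i, level β c r L = i + 1 ∧ Linked β (L i) c := by
  classical
  obtain ⟨i, hi, hl⟩ := h
  exact ⟨_, rfl, Nat.findGreatest_spec (P := fun i => Linked β (L i) c) hi hl⟩

lemma not_linked_of_level_le (h0 : ∀ i, r < i → L i = ∅) {i : ℕ} (hi : level β c r L ≤ i) :
    ¬ Linked β (L i) c := by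
  classical
  by_cases hr : i ≤ r
  · exact Nat.findGreatest_is_greatest (P := fun i => Linked β (L i) c)
      (Nat.lt_of_succ_le hi) hr
  · rw [h0 i (by omega)]
    exact not_linked_empty c

lemma push_of_linked (h : ∃ i ≤ r, Linked β (L i) c) :
    push β c r L = Function.update L (level β c r L) (insert c (L (level β c r L))) := if_pos h

lemma push_of_not_linked (h : ¬ ∃ i ≤ r, Linked β (L i) c) : push β c r L = L := if_neg h

/-- The event goes directly below the deepest layer linked to it, so its own link is present, and
enlarging a layer destroys no link of the layer below. -/
lemma push_mem_heaps {S : Finset ι} (hc : c ∈ C) (hL : L ∈ heaps β C r S) :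
    push β c r L ∈ heaps β C (r + 1) S := by
  by_cases h : ∃ i ≤ r, Linked β (L i) c
  · rw [push_of_linked h]
    rw [mem_heaps] at hL ⊢
    obtain ⟨h0, h1, h2⟩ := hL
    obtain ⟨l, hl, hlink⟩ := level_spec h
    have hle := level_le (β := β) c r L
    rw [hl] at hle ⊢
    have hmono : ∀ i, L i ⊆ Function.update L (l + 1) (insert c (L (l + 1))) i := by
      intro i
      by_cases hi : i = l + 1
      · subst hi; simp
      · simp [Function.update_of_ne hi]
    refine ⟨?_, fun i x hx => ?_, fun i hi => ?_⟩
    · rw [Function.update_of_ne (by omega), h0]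
    · have key : x ∈ C ∧ Linked β (L i) x := by
        by_cases hi : i + 1 = l + 1
        · obtain rfl : i = l := by omega
          rw [Function.update_self, Finset.mem_insert] at hx
          rcases hx with rfl | hx
          · exact ⟨hc, hlink⟩
          · exact (mem_nbhd β C).1 (h1 i hx)
        · rw [Function.update_of_ne hi] at hx
          exact (mem_nbhd β C).1 (h1 i hx)
      obtain ⟨hxC, y, hy, hyx⟩ := key
      exact (mem_nbhd β C).2 ⟨hxC, y, hmono i hy, hyx⟩
    · rw [Function.update_of_ne (by omega)]
      exact h2 i (by omega)
  · rw [push_of_not_linked h]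
    exact heaps_subset_succ β C r S hL

/-- No layer from the level of insertion on is linked to `c`, so none contains `c`: the inserted
copy is the deepest occurrence of `c` and can be found and erased again. -/
lemma mem_push_iff (h0 : ∀ i, r < i → L i = ∅) (h : ∃ i ≤ r, Linked β (L i) c) :
    c ∈ push β c r L (level β c r L) ∧ (∀ i, level β c r L < i → c ∉ push β c r L i) ∧
      L = Function.update (push β c r L) (level β c r L)
        ((push β c r L (level β c r L)).erase c) := by
  rw [push_of_linked h]
  refine ⟨by simp, fun i hi hc => ?_, ?_⟩
  · rw [Function.update_of_ne (by omega)] at hc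
    exact not_linked_of_level_le h0 hi.le (linked_of_mem hc)
  · have hn : c ∉ L (level β c r L) := fun hc =>
      not_linked_of_level_le h0 le_rfl (linked_of_mem hc)
    rw [Function.update_self, Function.update_idem, Finset.erase_insert hn,
      Function.update_eq_self]

lemma not_mem_push (h0 : ∀ i, r < i → L i = ∅) (h : ¬ ∃ i ≤ r, Linked β (L i) c) (i : ℕ) :
    c ∉ push β c r L i := by
  rw [push_of_not_linked h]
  intro hc
  by_cases hi : i ≤ r
  · exact h ⟨i, hi, linked_of_mem hc⟩
  · rw [h0 i (by omega)] at hc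
    simp at hc

/-- Whether `c` occurs in the result reveals which case of `push` applied; if it does, its deepest
occurrence is what has to be removed. -/
lemma push_injective {L' : ℕ → Finset ι} (h0 : ∀ i, r < i → L i = ∅)
    (h0' : ∀ i, r < i → L' i = ∅) (he : push β c r L = push β c r L') : L = L' := by
  by_cases h : ∃ i ≤ r, Linked β (L i) c <;> by_cases h' : ∃ i ≤ r, Linked β (L' i) c
  · obtain ⟨h1, h2, h3⟩ := mem_push_iff h0 h
    obtain ⟨h1', h2', h3'⟩ := mem_push_iff h0' h'
    have hl : level β c r L = level β c r L' := by
      rcases lt_trichotomy (level β c r L) (level β c r L') with hlt | heq | hlt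
      · exact absurd (he ▸ h1') (h2 _ hlt)
      · exact heq
      · exact absurd (he ▸ h1) (h2' _ hlt)
    rw [h3, h3', he, hl]
  · exact absurd (he ▸ (mem_push_iff h0 h).1) (not_mem_push h0' h' _)
  · exact absurd (he ▸ (mem_push_iff h0' h').1) (not_mem_push h0 h _)
  · rwa [push_of_not_linked h, push_of_not_linked h'] at he

lemma size_push (h0 : ∀ i, r < i → L i = ∅) (h : ∃ i ≤ r, Linked β (L i) c) :
    size (r + 1) (push β c r L) = size r L + 1 := by
  have hle := level_le (β := β) c r L
  have hn : c ∉ L (level β c r L) := fun hc =>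
    not_linked_of_level_le h0 le_rfl (linked_of_mem hc)
  have h1 : size (r + 1) L = size r L := by
    simp [size, Finset.sum_range_succ _ (r + 1), h0]
  have hm : level β c r L ∈ Finset.range (r + 1 + 1) := Finset.mem_range.2 (by omega)
  rw [← h1, push_of_linked h]
  unfold size
  rw [← Finset.add_sum_erase _ _ hm, ← Finset.add_sum_erase _ (fun i => (L i).card) hm,
    Function.update_self, Finset.card_insert_of_notMem hn]
  rw [Finset.sum_congr rfl fun i hi => by
    rw [Function.update_of_ne (Finset.ne_of_mem_erase hi)]]
  omega

lemma layerValue_eq_none {S : Finset ι} (h : ¬ Linked β S c) {x : Fin n}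
    (hx : (β c x).isSome) : layerValue β S x = none := by
  unfold layerValue
  rw [if_neg]
  rintro ⟨c', hc', hx'⟩
  exact h ⟨c', hc', Or.inr ⟨x, hx', hx⟩⟩

lemma layerValue_insert {S : Finset ι} (h : ¬ Linked β S c) :
    layerValue β (insert c S) = override (β c) (layerValue β S) := by
  funext x
  cases hx : β c x with
  | none => simp [layerValue, override, hx]
  | some b =>
    have hS : ∀ c' ∈ S, β c' x = none := by
      intro c' hc'
      by_contra hne
      exact h ⟨c', hc', Or.inr ⟨x, Option.isSome_iff_ne_none.2 hne, by simp [hx]⟩⟩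
    have h1 : (∃ c' ∈ S, β c' x = some true) ↔ False := by
      simp only [iff_false, not_exists, not_and]
      intro c' hc'
      simp [hS c' hc']
    simp only [layerValue, override, hx, Finset.mem_insert, exists_eq_or_imp, h1]
    cases b <;> simp

lemma prescribed_succ_of_eq_empty {i : ℕ} (h : L i = ∅) :
    prescribed β L (i + 1) = prescribed β L i := by
  funext x
  simp [prescribed, override, layerValue, h]

lemma prescribed_update_of_le {i l : ℕ} (h : i ≤ l) (S : Finset ι) :
    prescribed β (Function.update L l S) i = prescribed β L i := by
  induction i with
  | zero => rfl
  | succ i ih =>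
    simp only [prescribed]
    rw [ih (by omega), Function.update_of_ne (by omega)]

lemma override_assoc (r₁ r₂ r₃ : Fin n → Option Bool) :
    override (override r₁ r₂) r₃ = override r₁ (override r₂ r₃) := by
  funext x; simp [override, Option.or_assoc]

lemma override_left_comm {r₁ r₂ : Fin n → Option Bool} (h : ∀ x, (r₂ x).isSome → r₁ x = none)
    (r₃ : Fin n → Option Bool) :
    override r₁ (override r₂ r₃) = override r₂ (override r₁ r₃) := by
  funext x
  cases h2 : r₂ x with
  | none => simp [override, h2]
  | some b => simp [override, h2, h x (by simp [h2])]

/-- From its level on, the layers have no variable in common with `c`, so the values of `c` commute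
past them and end up with the highest priority. -/
lemma prescribed_push (h0 : ∀ i, r < i → L i = ∅) (h : ∃ i ≤ r, Linked β (L i) c) :
    prescribed β (push β c r L) (r + 2) = override (β c) (prescribed β L (r + 1)) := by
  rw [← prescribed_succ_of_eq_empty (h0 (r + 1) (by omega)), push_of_linked h]
  have hle := level_le (β := β) c r L
  have hn : ∀ i, level β c r L ≤ i → ¬ Linked β (L i) c := fun i hi =>
    not_linked_of_level_le h0 hi
  generalize level β c r L = l at hle hn
  have key : ∀ d, prescribed β (Function.update L l (insert c (L l))) (l + 1 + d) =
      override (β c) (prescribed β L (l + 1 + d)) := by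
    intro d
    induction d with
    | zero =>
      simp only [prescribed]
      rw [Function.update_self, prescribed_update_of_le le_rfl, layerValue_insert (hn l le_rfl),
        override_assoc]
    | succ d ih =>
      rw [← Nat.add_assoc]
      simp only [prescribed]
      rw [ih, Function.update_of_ne (by omega)]
      refine override_left_comm (fun x hx => ?_) _
      exact layerValue_eq_none (hn _ (by omega)) hx
  obtain ⟨d, hd⟩ : ∃ d, r + 2 = l + 1 + d := ⟨r + 1 - l, by omega⟩
  rw [hd, key]

lemma prescribed_eq_none (h : ¬ ∃ i ≤ r, Linked β (L i) c) {x : Fin n} (hx : (β c x).isSome)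
    {i : ℕ} (hi : i ≤ r + 1) : prescribed β L i x = none := by
  induction i with
  | zero => rfl
  | succ i ih =>
    simp only [prescribed, override]
    rw [ih (by omega), layerValue_eq_none (fun hl => h ⟨i, by omega, hl⟩) hx]
    rfl

lemma size_succ (h0 : ∀ i, r < i → L i = ∅) : size (r + 1) L = size r L := by
  simp [size, Finset.sum_range_succ _ (r + 1), h0]

lemma heapDensity_succ (p : ℝ) (h0 : ∀ i, r < i → L i = ∅) (σ : Fin n → Bool) :
    heapDensity β p (r + 1) L σ = heapDensity β p r L σ := by
  unfold heapDensity
  rw [prescribed_succ_of_eq_empty (h0 (r + 1) (by omega)), size_succ h0]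

/-- Resampling a violated event pushes it into the heap. -/
lemma mean_heapDensity_resample {k : ℕ} (hk : (dom (β c)).card = k) {σ : Fin n → Bool}
    (hσ : Agrees (β c) σ) (h0 : ∀ i, r < i → L i = ∅) :
    mean n (fun ω => heapDensity β ((1 / 2) ^ k) r L (resample (β c) σ ω)) =
      heapDensity β ((1 / 2) ^ k) (r + 1) (push β c r L) σ := by
  by_cases h : ∃ i ≤ r, Linked β (L i) c
  · unfold heapDensity
    -- The factor `(1 / 2) ^ k` from averaging over the resampled variables is exactly the weight of
    -- the one additional event.
    rw [mean_const_mul, mean_density_resample hσ, size_push h0 h, prescribed_push h0 h, hk]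
    ring
  · rw [push_of_not_linked h, heapDensity_succ _ h0]
    unfold heapDensity
    rw [mean_const_mul]
    -- An unlinked event changes no variable on which the heap prescribes a value.
    simp_rw [density_resample_of_disjoint (fun x hx => prescribed_eq_none h hx le_rfl) σ]
    rw [mean_const]

end Push

lemma heapDensity_nonneg {p : ℝ} (hp : 0 ≤ p) (r : ℕ) (L : ℕ → Finset ι) (σ : Fin n → Bool) :
    0 ≤ heapDensity β p r L σ := mul_nonneg (pow_nonneg hp _) (density_nonneg _ _)

lemma potential_nonneg {p : ℝ} (hp : 0 ≤ p) (r : ℕ) (D : ι) (σ : Fin n → Bool) :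
    0 ≤ potential β C p r D σ := Finset.sum_nonneg fun _ _ => heapDensity_nonneg hp _ _ _

lemma potential_le_succ {p : ℝ} (hp : 0 ≤ p) (r : ℕ) (D : ι) (σ : Fin n → Bool) :
    potential β C p r D σ ≤ potential β C p (r + 1) D σ := by
  unfold potential
  calc _ = ∑ L ∈ heaps β C r {D}, heapDensity β p (r + 1) L σ :=
        Finset.sum_congr rfl fun L hL =>
          (heapDensity_succ p ((mem_heaps β C).1 hL).2.2 σ).symm
    _ ≤ _ := Finset.sum_le_sum_of_subset_of_nonneg (heaps_subset_succ β C r _)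
        fun _ _ _ => heapDensity_nonneg hp _ _ _

lemma layerValue_singleton (D : ι) : layerValue β {D} = β D := by
  funext x
  cases h : β D x with
  | none => simp [layerValue, h]
  | some b => cases b <;> simp [layerValue, h]

/-- The heap that consists of the single event `D`. -/
lemma heapDensity_single {k : ℕ} {D : ι} (hk : (dom (β D)).card = k) {σ : Fin n → Bool}
    (hσ : Agrees (β D) σ) (r : ℕ) :
    heapDensity β ((1 / 2) ^ k) r (consLayer {D} fun _ => ∅) σ = 1 := by
  induction r with
  | zero =>
    have h1 : prescribed β (consLayer {D} fun _ => ∅) 1 = β D := by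
      funext x
      simp [prescribed, consLayer, override, layerValue_singleton]
    rw [heapDensity, Nat.zero_add, h1, density_of_agrees hσ, hk]
    simp only [size, consLayer, Nat.zero_add, Finset.range_one, Finset.sum_singleton,
      Finset.card_singleton, pow_one]
    rw [← mul_pow]
    norm_num
  | succ r ih =>
    rw [heapDensity_succ, ih]
    intro i hi
    cases i with
    | zero => omega
    | succ i => rfl

lemma one_le_potential_zero {k : ℕ} {D : ι} (hk : (dom (β D)).card = k) {σ : Fin n → Bool}
    (hσ : Agrees (β D) σ) : 1 ≤ potential β C ((1 / 2) ^ k) 0 D σ := by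
  simp [potential, heaps, -one_div, heapDensity_single hk hσ]

/-- The supermartingale property. By injectivity the averaged potential is the sum over the pushed
heaps, a subfamily of the heaps one layer deeper. If `c = D`, the heap `{D}` of weight `1` is left
over. -/
lemma mean_potential_resample {k : ℕ} {c : ι} (hc : c ∈ C) (hk : (dom (β c)).card = k)
    {σ : Fin n → Bool} (hσ : Agrees (β c) σ) (r : ℕ) (D : ι) :
    (if c = D then 1 else 0) +
      mean n (fun ω => potential β C ((1 / 2) ^ k) r D (resample (β c) σ ω)) ≤
      potential β C ((1 / 2) ^ k) (r + 1) D σ := by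
  classical
  have hp : (0 : ℝ) ≤ (1 / 2) ^ k := by positivity
  have h1 : mean n (fun ω => potential β C ((1 / 2) ^ k) r D (resample (β c) σ ω)) =
      ∑ L ∈ (heaps β C r {D}).image (push β c r), heapDensity β ((1 / 2) ^ k) (r + 1) L σ := by
    unfold potential
    rw [mean_sum, Finset.sum_image]
    · exact Finset.sum_congr rfl fun L hL =>
        mean_heapDensity_resample hk hσ ((mem_heaps β C).1 hL).2.2
    · intro L hL L' hL' he
      exact push_injective ((mem_heaps β C).1 hL).2.2 ((mem_heaps β C).1 hL').2.2 he
  have himg : (heaps β C r {D}).image (push β c r) ⊆ heaps β C (r + 1) {D} := by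
    intro L hL
    obtain ⟨L', hL', rfl⟩ := Finset.mem_image.1 hL
    exact push_mem_heaps hc hL'
  rw [h1]
  split_ifs with hcD
  · subst hcD
    rw [potential]
    refine le_of_eq_of_le (b := ∑ L ∈ insert (consLayer {c} fun _ => ∅)
      ((heaps β C r {c}).image (push β c r)), heapDensity β ((1 / 2) ^ k) (r + 1) L σ) ?_ ?_
    · rw [Finset.sum_insert, heapDensity_single hk hσ (r + 1)]
      -- Pushing `D` into a heap with top `D` puts it below the top, but the heap `{D}` has nothing
      -- there.
      intro hmem
      obtain ⟨L, hL, he⟩ := Finset.mem_image.1 hmem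
      have hL' := (mem_heaps β C).1 hL
      have hlink : ∃ i ≤ r, Linked β (L i) c :=
        ⟨0, Nat.zero_le r, linked_of_mem (by simp [hL'.1])⟩
      have hm := (mem_push_iff hL'.2.2 hlink).1
      obtain ⟨l, hl, -⟩ := level_spec hlink
      rw [he, hl] at hm
      simp [consLayer] at hm
    · refine Finset.sum_le_sum_of_subset_of_nonneg (Finset.insert_subset ?_ himg)
        fun _ _ _ => heapDensity_nonneg hp _ _ _
      refine (mem_heaps β C).2 ⟨rfl, fun i => by simp [consLayer], fun i hi => ?_⟩
      cases i with
      | zero => omega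
      | succ i => rfl
  · rw [zero_add]
    exact Finset.sum_le_sum_of_subset_of_nonneg himg fun _ _ _ => heapDensity_nonneg hp _ _ _


variable (β C) in
-- Summing out everything below a layer `S'` contributes at most `f` per event of `S'`; summing over
-- all candidates for `S'` is then a binomial expansion.
lemma sum_pow_size_le {p f : ℝ} (hp : 0 ≤ p) (hf : 0 ≤ f)
    (h : ∀ c ∈ C, p * (1 + f) ^ (nbhd β C {c}).card ≤ f) (r : ℕ) (S : Finset ι) :
    ∑ L ∈ heaps β C r S, p ^ size r L ≤ p ^ S.card * (1 + f) ^ (nbhd β C S).card := by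
  classical
  have one_le : ∀ j : ℕ, (1 : ℝ) ≤ (1 + f) ^ j := fun j => one_le_pow₀ (by linarith)
  induction r generalizing S with
  | zero =>
    simp only [heaps, Finset.sum_singleton, size, Nat.zero_add, Finset.range_one, consLayer]
    exact le_mul_of_one_le_right (pow_nonneg hp _) (one_le _)
  | succ r ih =>
    have hsize : ∀ L : ℕ → Finset ι, size (r + 1) (consLayer S L) = S.card + size r L := by
      intro L
      rw [size, Finset.sum_range_succ', add_comm]
      rfl
    have hinj : Function.Injective (consLayer S) := by
      intro L L' he
      funext i
      exact congrFun he (i + 1)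
    have hdisj : Set.PairwiseDisjoint ((nbhd β C S).powerset : Set (Finset ι))
        fun S' => (heaps β C r S').image (consLayer S) := by
      intro S₁ _ S₂ _ hne
      refine Finset.disjoint_left.2 fun L h1 h2 => hne ?_
      obtain ⟨L₁, hL₁, rfl⟩ := Finset.mem_image.1 h1
      obtain ⟨L₂, hL₂, he⟩ := Finset.mem_image.1 h2
      rw [← ((mem_heaps β C).1 hL₁).1, ← ((mem_heaps β C).1 hL₂).1, hinj he]
    -- The neighbourhood of `S'` is the union of those of its members, so the local condition
    -- applies to each member separately.
    have hbound : ∀ S' ⊆ C, p ^ S'.card * (1 + f) ^ (nbhd β C S').card ≤ f ^ S'.card := by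
      intro S' hS'
      have h1 : (1 + f) ^ (nbhd β C S').card ≤ ∏ c ∈ S', (1 + f) ^ (nbhd β C {c}).card := by
        rw [Finset.prod_pow_eq_pow_sum]
        refine pow_le_pow_right₀ (by linarith) ?_
        refine le_trans (Finset.card_le_card fun c hc => ?_) Finset.card_biUnion_le
        obtain ⟨hcC, c', hc', hadj⟩ := (mem_nbhd β C).1 hc
        exact Finset.mem_biUnion.2 ⟨c', hc', (mem_nbhd β C).2
          ⟨hcC, c', Finset.mem_singleton_self _, hadj⟩⟩
      calc _ ≤ p ^ S'.card * ∏ c ∈ S', (1 + f) ^ (nbhd β C {c}).card :=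
            mul_le_mul_of_nonneg_left h1 (pow_nonneg hp _)
        _ = ∏ c ∈ S', p * (1 + f) ^ (nbhd β C {c}).card := by
            rw [Finset.prod_mul_distrib, Finset.prod_const]
        _ ≤ ∏ c ∈ S', f := Finset.prod_le_prod
            (fun c _ => mul_nonneg hp (zero_le_one.trans (one_le _))) fun c hc => h c (hS' hc)
        _ = _ := Finset.prod_const _
    rw [heaps, Finset.sum_biUnion hdisj]
    calc _ = ∑ S' ∈ (nbhd β C S).powerset, p ^ S.card * ∑ L ∈ heaps β C r S', p ^ size r L := by
          refine Finset.sum_congr rfl fun S' _ => ?_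
          rw [Finset.sum_image hinj.injOn, Finset.mul_sum]
          exact Finset.sum_congr rfl fun L _ => by rw [hsize, pow_add]
      _ ≤ ∑ S' ∈ (nbhd β C S).powerset, p ^ S.card * f ^ S'.card := by
          refine Finset.sum_le_sum fun S' hS' => mul_le_mul_of_nonneg_left ?_ (pow_nonneg hp _)
          exact (ih S').trans (hbound S' ((Finset.mem_powerset.1 hS').trans
            (Finset.filter_subset _ _)))
      _ = _ := by
          rw [← Finset.mul_sum, add_comm 1 f, ← Finset.sum_pow_mul_eq_add_pow]
          simp

/-- At a uniform assignment every density has mean `1`, so only the sizes of the heaps matter. -/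
lemma mean_potential_le {p f : ℝ} (hp : 0 ≤ p) (hf : 0 ≤ f)
    (h : ∀ c ∈ C, p * (1 + f) ^ (nbhd β C {c}).card ≤ f) (r : ℕ) (D : ι) :
    mean n (fun ω => potential β C p r D fun x => ω x) ≤
      p * (1 + f) ^ (nbhd β C {D}).card := by
  unfold potential heapDensity
  rw [mean_sum]
  simp_rw [mean_const_mul, mean_density, mul_one]
  simpa using sum_pow_size_le β C hp hf h r {D}

end Heaps

/-! ### The resampling process, controlled by the potential -/

section Resampling

variable {n : ℕ} {ι : Type*} [DecidableEq ι] (β : ι → Fin n → Option Bool)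
  (sel : (Fin n → Bool) → Option ι)

/-- Resample the selected event, if there is one. -/
def resampleStep (σ : Fin n → Bool) (ω : ℕ → Bool) : Fin n → Bool :=
  match sel σ with
  | none => σ
  | some c => resample (β c) σ ω

/-- The assignment after `N` resampling steps; each step uses `n` coins. -/
def process : ℕ → (Fin n → Bool) → (ℕ → Bool) → Fin n → Bool
  | 0, σ, _ => σ
  | N + 1, σ, ω => process N (resampleStep β sel σ ω) (drop n ω)

/-- The assignment after `N` resampling steps from a random initial assignment. -/
def trial (N : ℕ) (ω : ℕ → Bool) : Fin n → Bool :=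
  process β sel N (fun x => ω x) (drop n ω)

lemma resampleStep_append (σ : Fin n → Bool) (ω ω' : ℕ → Bool) :
    resampleStep β sel σ (append n ω ω') = resampleStep β sel σ ω := by
  unfold resampleStep
  split
  · rfl
  · funext x
    simp [resample, append_apply_of_lt x.2]

lemma mean_process_succ (N : ℕ) (σ : Fin n → Bool) (g : (Fin n → Bool) → ℝ) :
    mean ((N + 1) * n) (fun ω => g (process β sel (N + 1) σ ω)) =
      mean n fun ω => mean (N * n) fun ω' =>
        g (process β sel N (resampleStep β sel σ ω) ω') := by
  rw [Nat.succ_mul, Nat.add_comm, mean_add_coins]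
  simp_rw [process, resampleStep_append, drop_append]

lemma mean_trial (N : ℕ) (g : (Fin n → Bool) → ℝ) :
    mean ((N + 1) * n) (fun ω => g (trial β sel N ω)) =
      mean n fun ω => mean (N * n) fun ω' => g (process β sel N (fun x => ω x) ω') := by
  rw [Nat.succ_mul, Nat.add_comm, mean_add_coins]
  simp_rw [trial, drop_append, append_apply_of_lt (Fin.is_lt _)]

lemma process_congr {N : ℕ} (σ : Fin n → Bool) {ω ω' : ℕ → Bool}
    (h : ∀ i < N * n, ω i = ω' i) : process β sel N σ ω = process β sel N σ ω' := by
  induction N generalizing σ ω ω' with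
  | zero => rfl
  | succ N ih =>
    have h1 : resampleStep β sel σ ω = resampleStep β sel σ ω' := by
      unfold resampleStep
      split
      · rfl
      · funext x
        unfold resample
        rw [h x (by rw [Nat.succ_mul]; omega)]
    rw [process, process, h1]
    exact ih _ fun i hi => h _ (by rw [Nat.succ_mul]; omega)

lemma trial_congr {N : ℕ} {ω ω' : ℕ → Bool} (h : ∀ i < (N + 1) * n, ω i = ω' i) :
    trial β sel N ω = trial β sel N ω' := by
  have h1 : (fun x : Fin n => ω x) = fun x : Fin n => ω' x := by
    funext x
    exact h _ (by rw [Nat.succ_mul]; omega)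
  rw [trial, trial, h1]
  exact process_congr β sel _ fun i hi => h _ (by rw [Nat.succ_mul]; omega)

variable {β sel} {C : Finset ι} {k : ℕ}

/-- The induction peels off the first step: the potential for `N` steps, averaged over that step, is
at most the potential for `N + 1`. The event `D` need not belong to the core. -/
lemma mean_agrees_process_le (hβ : ∀ c, (dom (β c)).card = k)
    (hsel : ∀ σ c, sel σ = some c → c ∈ C ∧ Agrees (β c) σ) (D : ι) (N : ℕ)
    (σ : Fin n → Bool) :
    mean (N * n) (fun ω => Set.indicator {σ | Agrees (β D) σ} 1 (process β sel N σ ω)) ≤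
      potential β C ((1 / 2) ^ k) N D σ := by
  have hp : (0 : ℝ) ≤ (1 / 2) ^ k := by positivity
  induction N generalizing σ with
  | zero =>
    simp only [process, mean_const]
    by_cases h : Agrees (β D) σ
    · rw [Set.indicator_of_mem (by exact h)]
      exact one_le_potential_zero (hβ D) h
    · rw [Set.indicator_of_notMem (by exact h)]
      exact potential_nonneg hp _ _ _
  | succ N ih =>
    rw [mean_process_succ β sel N σ]
    refine (mean_mono n fun ω => ih _).trans ?_
    unfold resampleStep
    split
    · rw [mean_const]
      exact potential_le_succ hp _ _ _
    · next c hc =>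
      obtain ⟨hcC, hcσ⟩ := hsel σ c hc
      refine le_trans ?_ (mean_potential_resample hcC (hβ c) hcσ N D)
      have : (0 : ℝ) ≤ if c = D then 1 else 0 := by split_ifs <;> norm_num
      linarith

lemma mean_alive_process_le (hβ : ∀ c, (dom (β c)).card = k)
    (hsel : ∀ σ c, sel σ = some c → c ∈ C ∧ Agrees (β c) σ) (N : ℕ)
    (σ : Fin n → Bool) :
    N * mean (N * n) (fun ω => Set.indicator {σ | sel σ ≠ none} 1 (process β sel N σ ω)) ≤
      ∑ D ∈ C, potential β C ((1 / 2) ^ k) N D σ := by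
  have hp : (0 : ℝ) ≤ (1 / 2) ^ k := by positivity
  induction N generalizing σ with
  | zero =>
    rw [Nat.cast_zero, zero_mul]
    exact Finset.sum_nonneg fun D _ => potential_nonneg hp _ _ _
  | succ N ih =>
    rw [mean_process_succ β sel N σ]
    cases hc : sel σ with
    | none =>
      have hstep : ∀ ω, resampleStep β sel σ ω = σ := fun ω => by
        unfold resampleStep; simp [hc]
      have hproc : ∀ N ω, process β sel N σ ω = σ := by
        intro N
        induction N with
        | zero => intro ω; rfl
        | succ N ih => intro ω; rw [process, hstep, ih]
      simp_rw [hstep, hproc]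
      rw [Set.indicator_of_notMem (by simp [hc])]
      rw [mean_const, mean_const, mul_zero]
      exact Finset.sum_nonneg fun D _ => potential_nonneg hp _ _ _
    | some c =>
      obtain ⟨hcC, hcσ⟩ := hsel σ c hc
      have hstep : ∀ ω, resampleStep β sel σ ω = resample (β c) σ ω := fun ω => by
        unfold resampleStep; simp [hc]
      simp_rw [hstep]
      have h1 := mean_mono n fun ω => ih (resample (β c) σ ω)
      rw [mean_const_mul, mean_sum] at h1
      have h2 := mean_mono n fun ω => mean_mono (N * n) fun ω' =>
        Set.indicator_le_self' (f := (1 : (Fin n → Bool) → ℝ)) (s := {σ | sel σ ≠ none})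
          (fun _ _ => zero_le_one) (process β sel N (resample (β c) σ ω) ω')
      simp only [Pi.one_apply, mean_const] at h2
      have h3 := Finset.sum_le_sum fun D (_ : D ∈ C) =>
        mean_potential_resample hcC (hβ c) hcσ N D
      rw [Finset.sum_add_distrib, Finset.sum_ite_eq, if_pos hcC] at h3
      push_cast
      linarith

/-- The probability that the event `D` occurs at the end. -/
lemma mean_agrees_trial_le (hβ : ∀ c, (dom (β c)).card = k)
    (hsel : ∀ σ c, sel σ = some c → c ∈ C ∧ Agrees (β c) σ) {f : ℝ} (hf : 0 ≤ f)
    (h : ∀ c ∈ C, (1 / 2) ^ k * (1 + f) ^ (nbhd β C {c}).card ≤ f) (D : ι) (N : ℕ) :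
    mean ((N + 1) * n) (fun ω => Set.indicator {σ | Agrees (β D) σ} 1 (trial β sel N ω)) ≤
      (1 / 2) ^ k * (1 + f) ^ (nbhd β C {D}).card := by
  rw [mean_trial]
  exact (mean_mono n fun ω => mean_agrees_process_le hβ hsel D N _).trans
    (mean_potential_le (by positivity) hf h N D)

/-- The probability that the process has not terminated after `N` steps. -/
lemma mean_alive_trial_le (hβ : ∀ c, (dom (β c)).card = k)
    (hsel : ∀ σ c, sel σ = some c → c ∈ C ∧ Agrees (β c) σ) {f : ℝ} (hf : 0 ≤ f)
    (h : ∀ c ∈ C, (1 / 2) ^ k * (1 + f) ^ (nbhd β C {c}).card ≤ f) (N : ℕ) :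
    N * mean ((N + 1) * n) (fun ω => Set.indicator {σ | sel σ ≠ none} 1 (trial β sel N ω)) ≤
      C.card * f := by
  rw [mean_trial, ← mean_const_mul]
  refine (mean_mono n fun ω => mean_alive_process_le hβ hsel N _).trans ?_
  rw [mean_sum, ← nsmul_eq_mul]
  refine Finset.sum_le_card_nsmul _ _ _ fun D hD => ?_
  exact (mean_potential_le (by positivity) hf h N D).trans (h D hD)

end Resampling

end MoserTardos

/-! ## Programs for the random access machine -/

namespace RandRAM

open Coins MoserTardos

/-- Started in `s` with coins `ω`, the program `P` halts within `t` steps, uses `d` coins, and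
reaches a store that satisfies `Q`. -/
def Spec (P : Prog) (s : Store) (ω : ℕ → Bool) (t d : ℕ) (Q : Store → Prop) : Prop :=
  ∃ s' t', t' ≤ t ∧ Q s' ∧ ∀ K, step^[t'] ⟨P :: K, s, ω⟩ = ⟨K, s', drop d ω⟩

/-! ### Composition rules for time and coins -/

section Rules

variable {P p q : Prog} {s : Store} {ω : ℕ → Bool} {t t' t₁ t₂ d d' d₁ d₂ : ℕ}
  {Q Q' : Store → Prop}

lemma Spec.mono (h : Spec P s ω t d Q) (ht : t ≤ t') (hd : d = d') (hQ : ∀ s', Q s' → Q' s') :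
    Spec P s ω t' d' Q' := by
  obtain ⟨s', t₀, h1, h2, h3⟩ := h
  exact ⟨s', t₀, h1.trans ht, hQ _ h2, hd ▸ h3⟩

lemma spec_skip (h : Q s) : Spec .skip s ω 1 0 Q := ⟨s, 1, le_rfl, h, fun _ => rfl⟩

lemma spec_set {x : ℕ} {e : Expr} (h : Q (s.setReg x (e.eval s))) : Spec (.set x e) s ω 1 0 Q :=
  ⟨_, 1, le_rfl, h, fun _ => rfl⟩

lemma spec_store {a i e : Expr} (h : Q (s.setMem (a.eval s) (i.eval s) (e.eval s))) :
    Spec (.store a i e) s ω 1 0 Q := ⟨_, 1, le_rfl, h, fun _ => rfl⟩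

lemma spec_flip {x : ℕ} (h : Q (s.setReg x (ω 0).toNat)) : Spec (.flip x) s ω 1 1 Q :=
  ⟨_, 1, le_rfl, h, fun _ => rfl⟩

lemma spec_seq (h : Spec p s ω t₁ d₁ fun s' => Spec q s' (drop d₁ ω) t₂ d₂ Q) :
    Spec (.seq p q) s ω (t₁ + t₂ + 1) (d₁ + d₂) Q := by
  obtain ⟨s₁, a, ha, ⟨s₂, b, hb, hQ, h2⟩, h1⟩ := h
  refine ⟨s₂, b + (a + 1), by omega, hQ, fun K => ?_⟩
  rw [Function.iterate_add_apply, Function.iterate_succ_apply]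
  change step^[b] (step^[a] ⟨p :: q :: K, s, ω⟩) = _
  rw [h1, h2, drop_drop]

lemma spec_ite {e : Expr} (h1 : e.eval s ≠ 0 → Spec p s ω t d Q)
    (h2 : e.eval s = 0 → Spec q s ω t d Q) : Spec (.ite e p q) s ω (t + 1) d Q := by
  by_cases he : e.eval s = 0
  · obtain ⟨s', a, ha, hQ, h⟩ := h2 he
    refine ⟨s', a + 1, by omega, hQ, fun K => ?_⟩
    rw [Function.iterate_succ_apply]
    change step^[a] ⟨(if e.eval s ≠ 0 then p else q) :: K, s, ω⟩ = _
    rw [if_neg (not_not.2 he), h]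
  · obtain ⟨s', a, ha, hQ, h⟩ := h1 he
    refine ⟨s', a + 1, by omega, hQ, fun K => ?_⟩
    rw [Function.iterate_succ_apply]
    change step^[a] ⟨(if e.eval s ≠ 0 then p else q) :: K, s, ω⟩ = _
    rw [if_pos he, h]

/-- Run the body with register `x` counting from `0` up to the value of register `y`. -/
def forLoop (x y : ℕ) (body : Prog) : Prog :=
  .seq (.set x (.const 0)) (.while (.lt (.reg x) (.reg y))
    (.seq body (.set x (.add (.reg x) (.const 1)))))

/-- Each iteration uses exactly `d` coins, so iteration `j` starts at coin `j * d`. It spends three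
steps besides the body: test, sequencing and increment. -/
lemma spec_forLoop {x y L : ℕ} (I : ℕ → Store → Prop) (hI : ∀ j s', I j s' → s'.reg x = j)
    (hy : ∀ j s', I j s' → s'.reg y = L) (h0 : I 0 (s.setReg x 0))
    (hstep : ∀ j s', j < L → I j s' →
      Spec p s' (drop (j * d) ω) t d fun s'' => I (j + 1) (s''.setReg x (s''.reg x + 1))) :
    Spec (forLoop x y p) s ω (L * (t + 3) + 3) (L * d) (I L) := by
  have main : ∀ r j s', j + r = L → I j s' →
      Spec (.while (.lt (.reg x) (.reg y)) (.seq p (.set x (.add (.reg x) (.const 1)))))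
        s' (drop (j * d) ω) (r * (t + 3) + 1) (r * d) (I L) := by
    intro r
    induction r with
    | zero =>
      intro j s' hj hIj
      have hcond : (Expr.lt (.reg x) (.reg y)).eval s' = 0 := by
        simp only [Expr.eval, hI _ _ hIj, hy _ _ hIj]
        rw [if_neg (by omega)]
      refine ⟨s', 1, by omega, by rwa [← hj], fun K => ?_⟩
      rw [Function.iterate_one, zero_mul, drop_zero]
      simp only [step, hcond]
      simp
    | succ r ih =>
      intro j s' hj hIj
      have hcond : (Expr.lt (.reg x) (.reg y)).eval s' ≠ 0 := by
        simp only [Expr.eval, hI _ _ hIj, hy _ _ hIj]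
        rw [if_pos (by omega)]
        exact one_ne_zero
      have hseq : Spec (.seq p (.set x (.add (.reg x) (.const 1)))) s' (drop (j * d) ω)
          (t + 1 + 1) (d + 0) (I (j + 1)) := by
        refine spec_seq ((hstep j s' (by omega) hIj).mono le_rfl rfl fun s'' h => ?_)
        exact spec_set h
      obtain ⟨s₁, a, ha, hs₁, h1⟩ := hseq
      obtain ⟨s₂, b, hb, hs₂, h2⟩ := ih (j + 1) s₁ (by omega) hs₁
      refine ⟨s₂, b + (a + 1), ?_, hs₂, fun K => ?_⟩
      · rw [Nat.succ_mul]; omega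
      · rw [Function.iterate_add_apply, Function.iterate_succ_apply]
        have : step ⟨.while (.lt (.reg x) (.reg y))
            (.seq p (.set x (.add (.reg x) (.const 1)))) :: K, s', drop (j * d) ω⟩ =
            ⟨.seq p (.set x (.add (.reg x) (.const 1))) :: .while (.lt (.reg x) (.reg y))
            (.seq p (.set x (.add (.reg x) (.const 1)))) :: K, s', drop (j * d) ω⟩ := by
          simp only [step, if_pos hcond]
        rw [this, h1]
        have e : drop (d + 0) (drop (j * d) ω) = drop ((j + 1) * d) ω := by
          rw [drop_drop, Nat.succ_mul]; rfl
        rw [e, h2, drop_drop, drop_drop]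
        congr 2
        ring
  have hset : Spec (.set x (.const 0)) s ω 1 0 fun s' => Spec (.while (.lt (.reg x) (.reg y))
      (.seq p (.set x (.add (.reg x) (.const 1))))) s' (drop 0 ω) (L * (t + 3) + 1)
        (L * d) (I L) := by
    refine spec_set ?_
    have := main L 0 _ (by omega) h0
    rwa [zero_mul] at this
  exact (spec_seq hset).mono (by omega) (by omega) fun _ h => h

lemma Spec.run_eq (h : Spec P s ω t d Q) :
    ∃ s', Q s' ∧ ∀ T, t ≤ T → run P s ω T = ⟨[], s', drop d ω⟩ := by
  obtain ⟨s', a, ha, hQ, h⟩ := h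
  refine ⟨s', hQ, fun T hT => ?_⟩
  obtain ⟨b, rfl⟩ : ∃ b, T = b + a := ⟨T - a, by omega⟩
  rw [run, Function.iterate_add_apply, h]
  exact Function.iterate_fixed rfl b

end Rules

/-! ### Registers and arrays left unchanged -/

section Frame

/-- The two stores agree on the registers below `b` and on all arrays except array `0`. -/
def Frame (b : ℕ) (s s' : Store) : Prop :=
  (∀ x < b, s'.reg x = s.reg x) ∧ ∀ a, a ≠ 0 → s'.mem a = s.mem a

variable {b b' x i v : ℕ} {s s' s'' : Store}

lemma Frame.refl (b : ℕ) (s : Store) : Frame b s s := ⟨fun _ _ => rfl, fun _ _ => rfl⟩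

lemma Frame.trans (h : Frame b s s') (h' : Frame b s' s'') : Frame b s s'' :=
  ⟨fun x hx => (h'.1 x hx).trans (h.1 x hx), fun a ha => (h'.2 a ha).trans (h.2 a ha)⟩

lemma Frame.mono (h : Frame b s s') (hb : b' ≤ b) : Frame b' s s' :=
  ⟨fun x hx => h.1 x (by omega), h.2⟩

lemma Frame.setReg (h : Frame b s s') (hx : b ≤ x) : Frame b s (s'.setReg x v) := by
  refine ⟨fun y hy => ?_, h.2⟩
  exact (Function.update_of_ne (by omega) _ _).trans (h.1 y hy)

lemma Frame.setMem (h : Frame b s s') : Frame b s (s'.setMem 0 i v) := by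
  refine ⟨h.1, fun a ha => ?_⟩
  exact (Function.update_of_ne ha _ _).trans (h.2 a ha)

@[simp] lemma setReg_reg (s : Store) (x v y : ℕ) :
    (s.setReg x v).reg y = if y = x then v else s.reg y := Function.update_apply _ _ _ _

@[simp] lemma setReg_mem (s : Store) (x v : ℕ) : (s.setReg x v).mem = s.mem := rfl

@[simp] lemma setMem_reg (s : Store) (a i v : ℕ) : (s.setMem a i v).reg = s.reg := rfl

@[simp] lemma setMem_mem_self (s : Store) (a i v j : ℕ) :
    (s.setMem a i v).mem a j = if j = i then v else s.mem a j := by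
  simp [Store.setMem, Function.update_apply]

end Frame

/-! ### Subroutines on formulas -/

section Formula

variable {n m k : ℕ} (F : Formula n m k) (C : Finset (Fin m))

/-- The store holds the input in its first registers and in the arrays other than array `0`. -/
structure Env (s : Store) : Prop where
  reg0 : s.reg 0 = n
  reg1 : s.reg 1 = m
  reg2 : s.reg 2 = k
  reg3 : s.reg 3 = C.card
  mem : ∀ a, a ≠ 0 → s.mem a = (input F C).mem a

lemma env_input : Env F C (input F C) := ⟨rfl, rfl, rfl, rfl, fun _ _ => rfl⟩

variable {F C} {s s' : Store}

lemma Env.frame (h : Env F C s) {b : ℕ} (hf : Frame b s s') (hb : 4 ≤ b) : Env F C s' :=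
  ⟨(hf.1 0 (by omega)).trans h.reg0, (hf.1 1 (by omega)).trans h.reg1,
    (hf.1 2 (by omega)).trans h.reg2, (hf.1 3 (by omega)).trans h.reg3,
    fun a ha => (hf.2 a ha).trans (h.mem a ha)⟩

lemma Env.mem_var (h : Env F C s) (j : Fin m) (a : Fin k) :
    s.mem (j + j + 2) a = (F j).var a := by
  rw [h.mem _ (by omega), input]
  have h1 : (j + j + 2 - 2) / 2 = (j : ℕ) := by omega
  have hc : 2 ≤ (j : ℕ) + j + 2 ∧ (j : ℕ) < m ∧ (a : ℕ) < k := ⟨by omega, j.2, a.2⟩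
  simp only [if_neg (show (j : ℕ) + j + 2 ≠ 1 by omega),
    if_pos (show ((j : ℕ) + j + 2) % 2 = 0 by omega), h1, dif_pos hc]

lemma Env.mem_sign (h : Env F C s) (j : Fin m) (a : Fin k) :
    s.mem (j + j + 3) a = ((F j).sign a).toNat := by
  rw [h.mem _ (by omega), input]
  have h1 : (j + j + 3 - 2) / 2 = (j : ℕ) := by omega
  have hc : 2 ≤ (j : ℕ) + j + 3 ∧ (j : ℕ) < m ∧ (a : ℕ) < k := ⟨by omega, j.2, a.2⟩
  simp only [if_neg (show (j : ℕ) + j + 3 ≠ 1 by omega),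
    if_neg (show ((j : ℕ) + j + 3) % 2 ≠ 0 by omega), h1, dif_pos hc]

lemma Env.mem_core (h : Env F C s) {i : ℕ} (hi : i < (C.sort (· ≤ ·)).length) :
    s.mem 1 i = ((C.sort (· ≤ ·))[i] : Fin m) := by
  rw [h.mem _ (by omega), input]
  simp only [if_true]
  rw [List.getD_eq_getElem _ _ (by simpa using hi), List.getElem_map]

/-- Array `0` holds the assignment `σ` from index `o` on. -/
def Holds (s : Store) (o : ℕ) (σ : Fin n → Bool) : Prop :=
  ∀ v : Fin n, s.mem 0 (o + v) = (σ v).toNat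

/-- This keeps `k` out of the time bounds: a loop over literals takes `O(n)` steps. -/
lemma width_le (F : Formula n m k) (j : Fin m) : k ≤ n := by
  simpa using Fintype.card_le_of_embedding (F j).var

/-- Register `14` becomes `1` if the clause in register `13` is violated, and `0` otherwise. -/
def evalClause : Prog :=
  .seq (.set 14 (.const 1)) (forLoop 15 2
    (.ite (.eq (.load (.const 0) (.load (.add (.add (.reg 13) (.reg 13)) (.const 2)) (.reg 15)))
      (.load (.add (.add (.reg 13) (.reg 13)) (.const 3)) (.reg 15)))
      (.set 14 (.const 0)) .skip))

lemma toNat_inj {a b : Bool} : a.toNat = b.toNat ↔ a = b := by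
  cases a <;> cases b <;> simp

lemma spec_evalClause {σ : Fin n → Bool} {j : Fin m} {ω : ℕ → Bool} (he : Env F C s)
    (hσ : Holds s 0 σ) (hj : s.reg 13 = j) :
    Spec evalClause s ω (5 * n + 5) 0 fun s' => Frame 14 s s' ∧ s'.mem 0 = s.mem 0 ∧
      s'.reg 14 = if (F j).Satisfied σ then 0 else 1 := by
  classical
  have hk := width_le F j
  let I : ℕ → Store → Prop := fun i s' => s'.reg 15 = i ∧ Frame 14 s s' ∧ s'.mem 0 = s.mem 0 ∧
    s'.reg 14 = if ∃ a : Fin k, (a : ℕ) < i ∧ σ ((F j).var a) = (F j).sign a then 0 else 1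
  have hloop : Spec (forLoop 15 2
    (.ite (.eq (.load (.const 0) (.load (.add (.add (.reg 13) (.reg 13)) (.const 2)) (.reg 15)))
      (.load (.add (.add (.reg 13) (.reg 13)) (.const 3)) (.reg 15)))
      (.set 14 (.const 0)) .skip)) (s.setReg 14 1) ω (k * (2 + 3) + 3) (k * 0) (I k) := by
    refine spec_forLoop I (fun j s' h => h.1)
      (fun j s' h => (he.frame h.2.1 (by norm_num)).reg2) ?_ ?_
    · exact ⟨by simp, ((Frame.refl 14 s).setReg (by norm_num)).setReg (by norm_num), rfl,
        by simp⟩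
    · rintro i s' hi ⟨h15, hf, hm, h14⟩
      have he' := he.frame hf (by norm_num)
      have h13 : s'.reg 13 = j := (hf.1 13 (by norm_num)).trans hj
      have hv : s'.mem (j + j + 2) i = (F j).var ⟨i, hi⟩ := he'.mem_var j ⟨i, hi⟩
      have hs : s'.mem (j + j + 3) i = ((F j).sign ⟨i, hi⟩).toNat := he'.mem_sign j ⟨i, hi⟩
      have hx : s'.mem 0 ((F j).var ⟨i, hi⟩ : ℕ) = (σ ((F j).var ⟨i, hi⟩)).toNat := by
        have := hσ ((F j).var ⟨i, hi⟩)
        rwa [Nat.zero_add, ← hm] at this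
      have hiff : (∃ a : Fin k, (a : ℕ) < i + 1 ∧ σ ((F j).var a) = (F j).sign a) ↔
          (∃ a : Fin k, (a : ℕ) < i ∧ σ ((F j).var a) = (F j).sign a) ∨
            σ ((F j).var ⟨i, hi⟩) = (F j).sign ⟨i, hi⟩ := by
        constructor
        · rintro ⟨a, ha, h⟩
          rcases Nat.lt_succ_iff_lt_or_eq.1 ha with h' | h'
          · exact Or.inl ⟨a, h', h⟩
          · obtain rfl : a = ⟨i, hi⟩ := Fin.ext h'
            exact Or.inr h
        · rintro (⟨a, ha, h⟩ | h)
          · exact ⟨a, by omega, h⟩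
          · exact ⟨⟨i, hi⟩, Nat.lt_succ_self i, h⟩
      refine spec_ite (fun hc => spec_set ?_) fun hc => spec_skip ?_
      · simp only [Expr.eval, h13, h15, hv, hs, hx, toNat_inj, ne_eq, ite_eq_right_iff,
          one_ne_zero, imp_false, not_not] at hc
        refine ⟨by simp [h15], (hf.setReg (by norm_num)).setReg (by norm_num), hm, ?_⟩
        rw [if_pos (hiff.2 (Or.inr hc))]
        simp [Expr.eval]
      · simp only [Expr.eval, h13, h15, hv, hs, hx, toNat_inj, ite_eq_right_iff,
          one_ne_zero, imp_false] at hc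
        refine ⟨by simp [h15], hf.setReg (by norm_num), hm, ?_⟩
        simp only [hiff, hc, or_false]
        simpa using h14
  refine (spec_seq (spec_set hloop)).mono (by omega) rfl ?_
  rintro s' ⟨-, hf, hm, h14⟩
  refine ⟨hf, hm, ?_⟩
  rw [h14]
  congr 1
  exact propext ⟨fun ⟨a, _, h⟩ => ⟨a, h⟩, fun ⟨a, h⟩ => ⟨a, a.2, h⟩⟩

/-- Write `n` coins to array `0`, from index `off` on. -/
def flipAll (off : Expr) : Prog :=
  forLoop 12 0 (.seq (.flip 16) (.store (.const 0) (.add off (.reg 12)) (.reg 16)))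

lemma spec_flipAll {off : Expr} {o : ℕ} {ω : ℕ → Bool} (he : Env F C s)
    (ho : ∀ s', Frame 12 s s' → off.eval s' = o) :
    Spec (flipAll off) s ω (6 * n + 3) n fun s' => Frame 12 s s' ∧
      Holds s' o (fun v : Fin n => ω v) ∧
      ∀ i, i < o ∨ o + n ≤ i → s'.mem 0 i = s.mem 0 i := by
  let I : ℕ → Store → Prop := fun j s' => s'.reg 12 = j ∧ Frame 12 s s' ∧
    (∀ v < j, s'.mem 0 (o + v) = (ω v).toNat) ∧
      ∀ i, i < o ∨ o + n ≤ i → s'.mem 0 i = s.mem 0 i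
  refine (spec_forLoop (t := 3) (d := 1) (L := n) I (fun j s' h => h.1)
      (fun j s' h => (he.frame h.2.1 (by norm_num)).reg0) ?_ ?_).mono (by omega) (by omega) ?_
  · exact ⟨by simp, (Frame.refl 12 s).setReg (by norm_num), fun v hv => absurd hv (by omega),
      fun _ _ => rfl⟩
  · rintro j s' hj ⟨h12, hf, hm, hm'⟩
    refine (spec_seq (spec_flip (spec_store ?_))).mono le_rfl rfl fun _ h => h
    have hf' : Frame 12 s (s'.setReg 16 (drop (j * 1) ω 0).toNat) := hf.setReg (by norm_num)
    have hω : drop j ω 0 = ω j := by simp [drop]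
    simp only [Expr.eval, ho _ hf']
    refine ⟨by simp [h12], hf'.setMem.setReg (by norm_num), fun v hv => ?_, fun i hi => ?_⟩
    · by_cases hvj : v = j
      · subst hvj; simp [h12, hω]
      · simp [h12, hvj, hm v (by omega)]
    · have : i ≠ o + j := by omega
      simp [h12, this, hm' i hi]
  · rintro s' ⟨-, hf, hm, hm'⟩
    exact ⟨hf, fun v => hm v v.2, hm'⟩

/-- Copy `n` entries of array `0`. -/
def copyAll (src dst : Expr) : Prog :=
  forLoop 12 0 (.store (.const 0) (.add dst (.reg 12)) (.load (.const 0) (.add src (.reg 12))))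

lemma spec_copyAll {src dst : Expr} {a o : ℕ} {ω : ℕ → Bool} {σ : Fin n → Bool} (he : Env F C s)
    (ha : ∀ s', Frame 12 s s' → src.eval s' = a) (ho : ∀ s', Frame 12 s s' → dst.eval s' = o)
    (hd : a + n ≤ o ∨ o + n ≤ a) (hσ : Holds s a σ) :
    Spec (copyAll src dst) s ω (4 * n + 3) 0 fun s' => Frame 12 s s' ∧ Holds s' o σ ∧
      ∀ i, i < o ∨ o + n ≤ i → s'.mem 0 i = s.mem 0 i := by
  let I : ℕ → Store → Prop := fun j s' => s'.reg 12 = j ∧ Frame 12 s s' ∧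
    (∀ v : Fin n, (v : ℕ) < j → s'.mem 0 (o + v) = (σ v).toNat) ∧
      ∀ i, i < o ∨ o + n ≤ i → s'.mem 0 i = s.mem 0 i
  refine (spec_forLoop (t := 1) (d := 0) (L := n) I (fun j s' h => h.1)
      (fun j s' h => (he.frame h.2.1 (by norm_num)).reg0) ?_ ?_).mono (by omega) (by omega) ?_
  · exact ⟨by simp, (Frame.refl 12 s).setReg (by norm_num), fun v hv => absurd hv (by omega),
      fun _ _ => rfl⟩
  · rintro j s' hj ⟨h12, hf, hm, hm'⟩
    refine spec_store ?_
    have hval : s'.mem 0 (a + j) = (σ ⟨j, hj⟩).toNat := by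
      rw [hm' _ (by omega)]
      exact hσ ⟨j, hj⟩
    simp only [Expr.eval, ho _ hf, ha _ hf, h12, hval]
    refine ⟨by simp [h12], hf.setMem.setReg (by norm_num), fun v hv => ?_, fun i hi => ?_⟩
    · by_cases hvj : (v : ℕ) = j
      · obtain rfl : v = ⟨j, hj⟩ := Fin.ext hvj
        simp
      · simp [hvj, hm v (by omega)]
    · have : i ≠ o + j := by omega
      simp [this, hm' i hi]
  · rintro s' ⟨-, hf, hm, hm'⟩
    exact ⟨hf, fun v => hm v v.2, hm'⟩

variable (F C)

/-- The last clause in a list that is violated. -/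
def lastViolated (l : List (Fin m)) (σ : Fin n → Bool) : Option (Fin m) :=
  l.foldl (fun acc j => if (F j).Satisfied σ then acc else some j) none

/-- The core clause that the algorithm resamples. -/
def selected (σ : Fin n → Bool) : Option (Fin m) := lastViolated F (C.sort (· ≤ ·)) σ

/-- A clause is coded by its index plus one. -/
def code : Option (Fin m) → ℕ
  | none => 0
  | some j => j + 1

lemma lastViolated_concat (l : List (Fin m)) (j : Fin m) (σ : Fin n → Bool) :
    lastViolated F (l ++ [j]) σ =
      if (F j).Satisfied σ then lastViolated F l σ else some j := by
  simp [lastViolated]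

/-- The analysis allows any choice among the violated core clauses; the last one is what remains
when the loop overwrites its register. -/
lemma lastViolated_spec (l : List (Fin m)) (σ : Fin n → Bool) :
    (∀ j, lastViolated F l σ = some j → j ∈ l ∧ ¬ (F j).Satisfied σ) ∧
      (lastViolated F l σ = none → ∀ j ∈ l, (F j).Satisfied σ) := by
  induction l using List.reverseRecOn with
  | nil => simp [lastViolated]
  | append_singleton l a ih =>
    rw [lastViolated_concat]
    split_ifs with h
    · refine ⟨fun j hj => ⟨List.mem_append_left _ (ih.1 j hj).1, (ih.1 j hj).2⟩, fun hn j hj => ?_⟩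
      rcases List.mem_append.1 hj with hj | hj
      · exact ih.2 hn j hj
      · rwa [List.mem_singleton.1 hj]
    · refine ⟨fun j hj => ?_, fun hn => by simp at hn⟩
      obtain rfl := Option.some.inj hj
      exact ⟨by simp, h⟩

lemma selected_some {σ : Fin n → Bool} {j : Fin m} (h : selected F C σ = some j) :
    j ∈ C ∧ ¬ (F j).Satisfied σ := by
  have := (lastViolated_spec F (C.sort (· ≤ ·)) σ).1 j h
  simpa using this

lemma selected_eq_none {σ : Fin n → Bool} :
    selected F C σ = none ↔ ∀ j ∈ C, (F j).Satisfied σ := by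
  constructor
  · intro h j hj
    exact (lastViolated_spec F (C.sort (· ≤ ·)) σ).2 h j (by simpa using hj)
  · intro h
    cases hs : selected F C σ with
    | none => rfl
    | some j => exact absurd (h j (selected_some F C hs).1) (selected_some F C hs).2

variable {F C}

/-- Put the code of the selected core clause into register `10`. -/
def findViolated : Prog :=
  .seq (.set 10 (.const 0)) (forLoop 12 3
    (.seq (.set 13 (.load (.const 1) (.reg 12))) (.seq evalClause
      (.ite (.reg 14) (.set 10 (.add (.reg 13) (.const 1))) .skip))))

lemma spec_findViolated {σ : Fin n → Bool} {ω : ℕ → Bool} (he : Env F C s) (hσ : Holds s 0 σ) :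
    Spec findViolated s ω (C.card * (5 * n + 13) + 5) 0 fun s' => Frame 10 s s' ∧
      s'.mem 0 = s.mem 0 ∧ s'.reg 10 = code (selected F C σ) ∧ s'.reg 11 = s.reg 11 := by
  set l := C.sort (· ≤ ·) with hl
  have hlen : l.length = C.card := Finset.length_sort _
  let I : ℕ → Store → Prop := fun i s' => s'.reg 12 = i ∧ Frame 10 s s' ∧ s'.mem 0 = s.mem 0 ∧
    s'.reg 10 = code (lastViolated F (l.take i) σ) ∧ s'.reg 11 = s.reg 11
  have hloop : Spec (forLoop 12 3
    (.seq (.set 13 (.load (.const 1) (.reg 12))) (.seq evalClause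
      (.ite (.reg 14) (.set 10 (.add (.reg 13) (.const 1))) .skip)))) (s.setReg 10 0) ω
      (C.card * (1 + (5 * n + 5 + 2 + 1) + 1 + 3) + 3) (C.card * (0 + (0 + 0))) (I C.card) := by
    refine spec_forLoop I (fun j s' h => h.1)
      (fun j s' h => (he.frame h.2.1 (by norm_num)).reg3) ?_ ?_
    · exact ⟨by simp, ((Frame.refl 10 s).setReg (by norm_num)).setReg (by norm_num), rfl,
        by simp [lastViolated, code], by simp⟩
    · rintro i s' hi ⟨h12, hf, hm, h10, h11⟩
      have hil : i < l.length := by omega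
      have he' := he.frame hf (by norm_num)
      have h1 : s'.mem 1 i = (l[i] : Fin m) := he'.mem_core hil
      refine spec_seq (spec_set (spec_seq (t₁ := 5 * n + 5) (t₂ := 2) ?_))
      have hf1 : Frame 10 s (s'.setReg 13 l[i]) := hf.setReg (by norm_num)
      simp only [Expr.eval, h12, h1]
      refine (spec_evalClause (σ := σ) (j := l[i]) (he.frame hf1 (by norm_num)) ?_
        (by simp)).mono le_rfl rfl ?_
      · intro v
        simp only [setReg_mem, hm]
        exact hσ v
      · rintro s₂ ⟨hf2, hm2, h14⟩
        have hf3 : Frame 10 s s₂ := hf1.trans (hf2.mono (by norm_num))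
        have htake : l.take (i + 1) = l.take i ++ [l[i]] := (List.take_concat_get' l i hil).symm
        have e12 : s₂.reg 12 = i := by rw [hf2.1 12 (by norm_num)]; simp [h12]
        have e13 : s₂.reg 13 = l[i] := by rw [hf2.1 13 (by norm_num)]; simp
        have e10 : s₂.reg 10 = s'.reg 10 := by rw [hf2.1 10 (by norm_num)]; simp
        have e11 : s₂.reg 11 = s'.reg 11 := by rw [hf2.1 11 (by norm_num)]; simp
        refine spec_ite (fun hc => spec_set ?_) fun hc => spec_skip ?_
        · have hns : ¬ (F l[i]).Satisfied σ := by
            intro hs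
            exact hc (by simp [Expr.eval, h14, hs])
          refine ⟨by simp [e12], (hf3.setReg (by norm_num)).setReg (by norm_num),
            by simp [hm2, hm], ?_, by simp [e11, h11]⟩
          rw [htake, lastViolated_concat, if_neg hns]
          simp [Expr.eval, e13, code]
        · have hs : (F l[i]).Satisfied σ := by
            by_contra hs
            rw [Expr.eval, h14, if_neg hs] at hc
            exact one_ne_zero hc
          refine ⟨by simp [e12], hf3.setReg (by norm_num), by simp [hm2, hm], ?_,
            by simp [e11, h11]⟩
          rw [htake, lastViolated_concat, if_pos hs]
          simp [e10, h10]
  refine (spec_seq (spec_set hloop)).mono (by ring_nf; omega) (by omega) ?_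
  rintro s' ⟨-, hf, hm, h10, h11⟩
  refine ⟨hf, hm, ?_, h11⟩
  rw [h10, ← hlen, List.take_length]
  rfl

/-- The partial assignment that violates the clause `j`. -/
noncomputable def badValue (F : Formula n m k) (j : Fin m) (x : Fin n) : Option Bool :=
  open Classical in
  if h : ∃ a, (F j).var a = x then some (!(F j).sign h.choose) else none

lemma badValue_var (j : Fin m) (a : Fin k) : badValue F j ((F j).var a) = some (!(F j).sign a) := by
  have h : ∃ a', (F j).var a' = (F j).var a := ⟨a, rfl⟩
  rw [badValue, dif_pos h, (F j).var.injective h.choose_spec]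

lemma isSome_badValue {j : Fin m} {x : Fin n} :
    (badValue F j x).isSome ↔ ∃ a, (F j).var a = x := by
  unfold badValue
  split_ifs with h <;> simp [h]

lemma agrees_badValue {j : Fin m} {σ : Fin n → Bool} :
    Agrees (badValue F j) σ ↔ ¬ (F j).Satisfied σ := by
  constructor
  · rintro h ⟨a, ha⟩
    have := h _ _ (badValue_var j a)
    rw [ha] at this
    simp at this
  · intro h x b hb
    obtain ⟨a, rfl⟩ := isSome_badValue.1 (by rw [hb]; rfl)
    rw [badValue_var] at hb
    obtain rfl := Option.some.inj hb
    rw [Bool.eq_not]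
    exact fun ha => h ⟨a, ha⟩

lemma card_dom_badValue (j : Fin m) : (dom (badValue F j)).card = k := by
  classical
  have : dom (badValue F j) = Finset.univ.map (F j).var := by
    ext x
    simp [dom, isSome_badValue]
  rw [this]
  simp

/-- Copy the coins that start at index `n` to the variables of the clause coded in
register `10`. -/
def copyClause : Prog :=
  forLoop 12 2 (.store (.const 0) (.load (.add (.reg 10) (.reg 10)) (.reg 12))
    (.load (.const 0) (.add (.reg 0) (.load (.add (.reg 10) (.reg 10)) (.reg 12)))))

lemma spec_copyClause {j : Fin m} {σ : Fin n → Bool} {ω ρ : ℕ → Bool} (he : Env F C s)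
    (hj : s.reg 10 = j + 1) (hσ : Holds s 0 σ) (hρ : Holds s n fun v : Fin n => ρ v) :
    Spec copyClause s ω (4 * n + 3) 0 fun s' => Frame 12 s s' ∧
      Holds s' 0 (resample (badValue F j) σ ρ) ∧ ∀ i, n ≤ i → s'.mem 0 i = s.mem 0 i := by
  classical
  have hk := width_le F j
  let I : ℕ → Store → Prop := fun i s' => s'.reg 12 = i ∧ Frame 12 s s' ∧
    (∀ v : Fin n, s'.mem 0 v =
      (if ∃ a : Fin k, (a : ℕ) < i ∧ (F j).var a = v then ρ v else σ v).toNat) ∧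
    ∀ i, n ≤ i → s'.mem 0 i = s.mem 0 i
  refine (spec_forLoop (t := 1) (d := 0) (L := k) I (fun j s' h => h.1)
      (fun j s' h => (he.frame h.2.1 (by norm_num)).reg2) ?_ ?_).mono (by omega) (by omega) ?_
  · refine ⟨by simp, (Frame.refl 12 s).setReg (by norm_num), fun v => ?_, fun _ _ => rfl⟩
    simpa using hσ v
  · rintro i s' hi ⟨h12, hf, hm, hm'⟩
    have he' := he.frame hf (by norm_num)
    -- Doubling the code `j + 1` gives the address of the array of variables of clause `j`.
    have h10 : s'.reg 10 + s'.reg 10 = j + j + 2 := by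
      rw [hf.1 10 (by norm_num), hj]; ring
    have hv : s'.mem (j + j + 2) i = (F j).var ⟨i, hi⟩ := he'.mem_var j ⟨i, hi⟩
    have hr : s'.mem 0 (n + (F j).var ⟨i, hi⟩) = (ρ ((F j).var ⟨i, hi⟩)).toNat := by
      rw [hm' _ (by omega)]
      exact hρ _
    refine spec_store ?_
    simp only [Expr.eval, h10, h12, hv, he'.reg0, hr]
    refine ⟨by simp [h12], hf.setMem.setReg (by norm_num), fun v => ?_, fun i' hi' => ?_⟩
    · by_cases hvi : v = (F j).var ⟨i, hi⟩
      · subst hvi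
        rw [if_pos ⟨⟨i, hi⟩, Nat.lt_succ_self i, rfl⟩]
        simp
      · have hiff : (∃ a : Fin k, (a : ℕ) < i + 1 ∧ (F j).var a = v) ↔
            ∃ a : Fin k, (a : ℕ) < i ∧ (F j).var a = v := by
          constructor
          · rintro ⟨a, ha, h⟩
            rcases Nat.lt_succ_iff_lt_or_eq.1 ha with h' | h'
            · exact ⟨a, h', h⟩
            · obtain rfl : a = ⟨i, hi⟩ := Fin.ext h'
              exact absurd h.symm hvi
          · rintro ⟨a, ha, h⟩
            exact ⟨a, by omega, h⟩
        have hvi' : (v : ℕ) ≠ (F j).var ⟨i, hi⟩ := fun h => hvi (Fin.ext h)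
        simp only [setReg_mem, setMem_mem_self, if_neg hvi', hiff]
        exact hm v
    · have : i' ≠ (F j).var ⟨i, hi⟩ := by omega
      simp [this, hm' i' hi']
  · rintro s' ⟨-, hf, hm, hm'⟩
    refine ⟨hf, fun v => ?_, hm'⟩
    rw [Nat.zero_add, hm, resample]
    congr 1
    refine if_congr ?_ rfl rfl
    rw [isSome_badValue]
    exact ⟨fun ⟨a, _, h⟩ => ⟨a, h⟩, fun ⟨a, h⟩ => ⟨a, a.2, h⟩⟩

/-- One resampling step. -/
def stepProg : Prog :=
  .seq findViolated (.seq (flipAll (.reg 0)) (.ite (.reg 10) copyClause .skip))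

/-- All `n` coins are flipped into the cells from `n` on, even if no clause is violated, so the
number of coins per step is fixed. Cells from `2 n` on are reserved for the kept assignment. -/
lemma spec_stepProg {σ : Fin n → Bool} {ω : ℕ → Bool} (he : Env F C s) (hσ : Holds s 0 σ) :
    Spec stepProg s ω (C.card * (5 * n + 13) + 10 * n + 15) n fun s' => Frame 10 s s' ∧
      Holds s' 0 (resampleStep (badValue F) (selected F C) σ ω) ∧
      ∀ i, n + n ≤ i → s'.mem 0 i = s.mem 0 i := by
  refine (spec_seq (d₁ := 0) (d₂ := n + 0) (t₂ := 6 * n + 3 + (4 * n + 3 + 1) + 1)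
    ((spec_findViolated (ω := ω) he hσ).mono le_rfl rfl ?_)).mono
    (by omega) (by omega) fun _ h => h
  rintro s₁ ⟨hf1, hm1, h10, -⟩
  have he1 := he.frame hf1 (by norm_num)
  refine spec_seq ((spec_flipAll he1 (o := n) fun s' hf => ?_).mono le_rfl rfl ?_)
  · exact (he1.frame hf (by norm_num)).reg0
  · rintro s₂ ⟨hf2, hρ, hm2⟩
    have he2 := he1.frame hf2 (by norm_num)
    have hf12 : Frame 10 s s₂ := hf1.trans (hf2.mono (by norm_num))
    have h10' : s₂.reg 10 = code (selected F C σ) := by rw [hf2.1 10 (by norm_num), h10]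
    have hσ2 : Holds s₂ 0 σ := fun v => by
      rw [hm2 _ (Or.inl (by omega)), hm1]
      exact hσ v
    refine spec_ite (fun hc => ?_) fun hc => ?_
    · cases hs : selected F C σ with
      | none => rw [hs] at h10'; exact absurd h10' hc
      | some j =>
        rw [hs] at h10'
        refine (spec_copyClause he2 h10' hσ2 hρ).mono le_rfl rfl ?_
        rintro s₃ ⟨hf3, hσ3, hm3⟩
        refine ⟨hf12.trans (hf3.mono (by norm_num)), ?_, fun i hi => ?_⟩
        · simpa only [resampleStep, hs, drop_zero] using hσ3
        · rw [hm3 i (by omega), hm2 i (by omega), hm1]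
    · cases hs : selected F C σ with
      | some j =>
        rw [Expr.eval, h10', hs] at hc
        simp [code] at hc
      | none =>
        refine (spec_skip (Q := fun s' => _) ?_).mono (by omega) rfl fun _ h => h
        refine ⟨hf12, ?_, fun i hi => ?_⟩
        · simpa only [resampleStep, hs] using hσ2
        · rw [hm2 i (by omega), hm1]

/-- A random assignment, followed by as many resampling steps as register `5` says. -/
def trialProg : Prog := .seq (flipAll (.const 0)) (forLoop 9 5 stepProg)

/-- The expectations peel off the first step; the loop invariant needs the last one. -/
lemma process_succ' {ι : Type*} (β : ι → Fin n → Option Bool)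
    (sel : (Fin n → Bool) → Option ι) (N : ℕ) (σ : Fin n → Bool) (ω : ℕ → Bool) :
    process β sel (N + 1) σ ω =
      resampleStep β sel (process β sel N σ ω) (drop (N * n) ω) := by
  induction N generalizing σ ω with
  | zero => simp [process, drop_zero]
  | succ N ih =>
    rw [process, ih, process, drop_drop, Nat.succ_mul, Nat.add_comm]

lemma spec_trialProg {ω : ℕ → Bool} {N : ℕ} (he : Env F C s) (hN : s.reg 5 = N) :
    Spec trialProg s ω (N * (C.card * (5 * n + 13) + 10 * n + 18) + 6 * n + 7) ((N + 1) * n)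
      fun s' => Frame 9 s s' ∧ Holds s' 0 (trial (badValue F) (selected F C) N ω) ∧
      ∀ i, n + n ≤ i → s'.mem 0 i = s.mem 0 i := by
  refine (spec_seq (d₁ := n) (d₂ := N * n)
    (t₂ := N * (C.card * (5 * n + 13) + 10 * n + 15 + 3) + 3)
    ((spec_flipAll he (o := 0) fun s' hf => rfl).mono le_rfl rfl ?_)).mono
    (by ring_nf; omega) (by ring) fun _ h => h
  rintro s₁ ⟨hf1, hσ1, hm1⟩
  let I : ℕ → Store → Prop := fun j s' => s'.reg 9 = j ∧ Frame 9 s s' ∧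
    Holds s' 0 (process (badValue F) (selected F C) j (fun x : Fin n => ω x) (drop n ω)) ∧
      ∀ i, n + n ≤ i → s'.mem 0 i = s.mem 0 i
  refine (spec_forLoop (L := N) I (fun j s' h => h.1)
      (fun j s' h => (h.2.1.1 5 (by norm_num)).trans hN) ?_ ?_).mono le_rfl rfl ?_
  · refine ⟨by simp, (hf1.mono (by norm_num)).setReg (by norm_num), fun v => ?_, fun i hi => ?_⟩
    · exact hσ1 v
    · exact hm1 i (by omega)
  · rintro j s' hj ⟨h9, hf, hσ, hm⟩
    refine (spec_stepProg (he.frame hf (by norm_num)) hσ).mono le_rfl rfl ?_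
    rintro s'' ⟨hf', hσ', hm'⟩
    refine ⟨?_, (hf.trans (hf'.mono (by norm_num))).setReg (by norm_num), fun v => ?_,
      fun i hi => (hm' i hi).trans (hm i hi)⟩
    · simp [hf'.1 9 (by norm_num), h9]
    · rw [process_succ']
      exact hσ' v
  · rintro s' ⟨-, hf, hσ, hm⟩
    exact ⟨hf, hσ, hm⟩

/-- The number of clauses that `σ` violates. -/
def violated (F : Formula n m k) (σ : Fin n → Bool) : ℕ :=
  ∑ j, if (F j).Satisfied σ then 0 else 1

/-- Put the number of violated clauses into register `11`. -/
def countViolated : Prog :=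
  .seq (.set 11 (.const 0)) (forLoop 12 1
    (.seq (.set 13 (.reg 12)) (.seq evalClause (.set 11 (.add (.reg 11) (.reg 14))))))

lemma spec_countViolated {σ : Fin n → Bool} {ω : ℕ → Bool} (he : Env F C s) (hσ : Holds s 0 σ) :
    Spec countViolated s ω (m * (5 * n + 12) + 5) 0 fun s' => Frame 11 s s' ∧
      s'.mem 0 = s.mem 0 ∧ s'.reg 11 = violated F σ := by
  let g : ℕ → ℕ := fun i => if h : i < m then if (F ⟨i, h⟩).Satisfied σ then 0 else 1 else 0
  let I : ℕ → Store → Prop := fun i s' => s'.reg 12 = i ∧ Frame 11 s s' ∧ s'.mem 0 = s.mem 0 ∧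
    s'.reg 11 = ∑ x ∈ Finset.range i, g x
  have hloop : Spec (forLoop 12 1
    (.seq (.set 13 (.reg 12)) (.seq evalClause (.set 11 (.add (.reg 11) (.reg 14))))))
      (s.setReg 11 0) ω
      (m * (1 + (5 * n + 5 + 1 + 1) + 1 + 3) + 3) (m * (0 + (0 + 0))) (I m) := by
    refine spec_forLoop I (fun j s' h => h.1)
      (fun j s' h => (he.frame h.2.1 (by norm_num)).reg1) ?_ ?_
    · exact ⟨by simp, ((Frame.refl 11 s).setReg (by norm_num)).setReg (by norm_num), rfl,
        by simp⟩
    · rintro i s' hi ⟨h12, hf, hm, h11⟩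
      refine spec_seq (spec_set (spec_seq (t₁ := 5 * n + 5) (t₂ := 1) ?_))
      simp only [Expr.eval, h12]
      have hf1 : Frame 11 s (s'.setReg 13 i) := hf.setReg (by norm_num)
      refine (spec_evalClause (σ := σ) (j := ⟨i, hi⟩) (he.frame hf1 (by norm_num)) ?_
        (by simp)).mono le_rfl rfl ?_
      · intro v
        simp only [setReg_mem, hm]
        exact hσ v
      · rintro s₂ ⟨hf2, hm2, h14⟩
        have hf3 : Frame 11 s s₂ := hf1.trans (hf2.mono (by norm_num))
        refine spec_set ⟨?_, (hf3.setReg (by norm_num)).setReg (by norm_num),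
          by simp [hm2, hm], ?_⟩
        · simp [hf2.1 12 (by norm_num), h12]
        · have hg : g i = if (F ⟨i, hi⟩).Satisfied σ then 0 else 1 := dif_pos hi
          rw [Finset.sum_range_succ, hg, ← h14, ← h11]
          simp [Expr.eval, hf2.1 11 (by norm_num)]
  refine (spec_seq (spec_set hloop)).mono (by ring_nf; omega) (by omega) ?_
  rintro s' ⟨-, hf, hm, h11⟩
  refine ⟨hf, hm, ?_⟩
  rw [h11, violated, ← Fin.sum_univ_eq_sum_range]
  exact Finset.sum_congr rfl fun j _ => dif_pos j.2

/-- Multiply register `5` by the `e`-th power of register `4`. -/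
def powProg : ℕ → Prog
  | 0 => .skip
  | e + 1 => .seq (powProg e) (.seq (.set 13 (.const 0)) (.seq
      (forLoop 12 4 (.set 13 (.add (.reg 13) (.reg 5)))) (.set 5 (.reg 13))))

/-- The machine only adds, so each multiplication is a loop; the exponent is a constant of the
program and is unrolled. -/
lemma spec_powProg {ω : ℕ → Bool} {A x : ℕ} (e : ℕ) (h4 : s.reg 4 = x) (h5 : s.reg 5 = A) :
    Spec (powProg e) s ω (e * (4 * x + 8) + 1) 0 fun s' => Frame 5 s s' ∧
      s'.reg 5 = A * x ^ e ∧ s'.mem 0 = s.mem 0 := by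
  induction e with
  | zero =>
    refine (spec_skip (Q := fun s' => _) ?_).mono (by omega) rfl fun _ h => h
    exact ⟨Frame.refl _ _, by simp [h5], rfl⟩
  | succ e ih =>
    refine (spec_seq (d₂ := 0) (t₂ := 1 + (x * (1 + 3) + 3 + 1 + 1) + 1)
      (ih.mono le_rfl rfl ?_)).mono (by ring_nf; omega) rfl fun _ h => h
    clear ih
    rintro s₁ ⟨hf1, h51, hm1⟩
    refine spec_seq (t₁ := 1) (t₂ := x * (1 + 3) + 3 + 1 + 1) (d₁ := 0) (d₂ := 0) (spec_set ?_)
    let I : ℕ → Store → Prop := fun i s' => s'.reg 12 = i ∧ Frame 6 s₁ s' ∧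
      s'.mem 0 = s₁.mem 0 ∧ s'.reg 13 = i * (A * x ^ e)
    refine (spec_seq (t₁ := x * (1 + 3) + 3) (t₂ := 1) (d₁ := x * 0) (d₂ := 0)
      (Q := fun s' => Frame 5 s s' ∧ s'.reg 5 = A * x ^ (e + 1) ∧ s'.mem 0 = s.mem 0) (Spec.mono
      (spec_forLoop (d := 0) (t := 1) (L := x) I (fun j s' h => h.1)
        (fun j s' h => ?_) ?_ ?_) le_rfl rfl ?_)).mono (by omega) (by omega) fun _ h => h
    · rw [h.2.1.1 4 (by norm_num), hf1.1 4 (by norm_num), h4]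
    · exact ⟨by simp, ((Frame.refl 6 s₁).setReg (by norm_num)).setReg (by norm_num), rfl,
        by simp [Expr.eval]⟩
    · rintro j s' hj ⟨h12, hf, hm, h13⟩
      refine spec_set ⟨by simp [h12], (hf.setReg (by norm_num)).setReg (by norm_num),
        by simp [hm], ?_⟩
      simp [Expr.eval, h13, hf.1 5 (by norm_num), h51]
      ring
    · rintro s' ⟨-, hf, hm, h13⟩
      refine spec_set ⟨hf1.trans ((hf.mono (by norm_num)).setReg (by norm_num)), ?_,
        by simp [hm, hm1]⟩
      simp [Expr.eval, h13]
      ring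

end Formula

/-! ### The two algorithms -/

section MainPrograms

variable {n m k : ℕ} {F : Formula n m k} {C : Finset (Fin m)} {s : Store} {ω : ℕ → Bool}

/-- Put `A * x ^ e` into register `5`. -/
def prelude (x : Expr) (A e : ℕ) : Prog :=
  .seq (.set 4 x) (.seq (.set 5 (.const A)) (powProg e))

lemma spec_prelude (x : Expr) (A e : ℕ) :
    Spec (prelude x A e) s ω (e * (4 * x.eval s + 8) + 5) 0 fun s' => Frame 4 s s' ∧
      s'.reg 5 = A * x.eval s ^ e ∧ s'.mem 0 = s.mem 0 := by
  refine (spec_seq (t₁ := 1) (t₂ := e * (4 * x.eval s + 8) + 1 + 1 + 1) (d₁ := 0) (d₂ := 0)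
    (spec_set ((spec_seq (t₁ := 1) (t₂ := e * (4 * x.eval s + 8) + 1) (d₁ := 0) (d₂ := 0)
      (spec_set ((spec_powProg (x := x.eval s) (A := A) e (by simp)
        (by simp [Expr.eval])).mono le_rfl rfl ?_))).mono (by omega) rfl fun _ h => h))).mono
        (by omega) rfl fun _ h => h
  rintro s' ⟨hf, h5, hm⟩
  refine ⟨?_, h5, hm⟩
  exact (((Frame.refl 4 s).setReg le_rfl).setReg (by norm_num)).trans (hf.mono (by norm_num))

/-- One trial with `(n + |C| + 1) ^ e` resampling steps. -/
def singleProg (e : ℕ) : Prog :=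
  .seq (prelude (.add (.add (.reg 0) (.reg 3)) (.const 1)) 1 e) trialProg

lemma spec_singleProg (e : ℕ) :
    Spec (singleProg e) (input F C) ω
      (e * (4 * (n + C.card + 1) + 8) + (n + C.card + 1) ^ e *
        (C.card * (5 * n + 13) + 10 * n + 18) + 6 * n + 13) (((n + C.card + 1) ^ e + 1) * n)
      fun s' => Holds s' 0
        (trial (badValue F) (selected F C) ((n + C.card + 1) ^ e) ω) := by
  refine (spec_seq (d₁ := 0) (d₂ := ((n + C.card + 1) ^ e + 1) * n)
    (t₂ := (n + C.card + 1) ^ e * (C.card * (5 * n + 13) + 10 * n + 18) + 6 * n + 7)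
    ((spec_prelude _ 1 e).mono le_rfl rfl ?_)).mono ?_ (by omega) fun _ h => h
  · rintro s₁ ⟨hf, h5, hm⟩
    refine (spec_trialProg ((env_input F C).frame hf le_rfl) (N := (n + C.card + 1) ^ e)
      ?_).mono le_rfl rfl fun s' h => h.2.1
    rw [h5, one_mul]
    rfl
  · have : (Expr.add (.add (.reg 0) (.reg 3)) (.const 1)).eval (input F C) =
      n + C.card + 1 := rfl
    rw [this]
    omega

/-- Run a trial; if it satisfies the core and violates fewer clauses than register `6` says, keep
the assignment. -/
def attemptProg : Prog :=
  .seq trialProg (.seq findViolated (.ite (.reg 10) .skip (.seq countViolated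
    (.ite (.lt (.reg 11) (.reg 6))
      (.seq (.set 6 (.reg 11)) (copyAll (.const 0) (.add (.reg 0) (.reg 0)))) .skip))))

/-- Register `6` bounds the number of clauses violated by the assignment that was kept. -/
def Kept (F : Formula n m k) (C : Finset (Fin m)) (s : Store) : Prop :=
  ∃ τ : Fin n → Bool, Holds s (n + n) τ ∧
    (s.reg 6 < m + 1 → selected F C τ = none ∧ violated F τ ≤ s.reg 6)

lemma spec_attemptProg {N : ℕ} (he : Env F C s) (hN : s.reg 5 = N) (hK : Kept F C s) :
    Spec attemptProg s ω (N * (C.card * (5 * n + 13) + 10 * n + 18) + C.card * (5 * n + 13) +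
      m * (5 * n + 12) + 10 * n + 27) ((N + 1) * n) fun s' =>
      Frame 6 s s' ∧ s'.reg 7 = s.reg 7 ∧ Kept F C s' ∧ s'.reg 6 ≤ s.reg 6 ∧
      (selected F C (trial (badValue F) (selected F C) N ω) = none →
        s'.reg 6 ≤ violated F (trial (badValue F) (selected F C) N ω)) := by
  set σ := trial (badValue F) (selected F C) N ω with hσdef
  refine (spec_seq (d₁ := (N + 1) * n) (d₂ := 0)
    (t₁ := N * (C.card * (5 * n + 13) + 10 * n + 18) + 6 * n + 7)
    (t₂ := C.card * (5 * n + 13) + m * (5 * n + 12) + 4 * n + 19)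
    ((spec_trialProg he hN).mono le_rfl rfl ?_)).mono (by omega) rfl fun _ h => h
  rintro s₁ ⟨hf1, hσ1, hm1⟩
  have he1 := he.frame hf1 (by norm_num)
  refine (spec_seq (d₁ := 0) (d₂ := 0) (t₁ := C.card * (5 * n + 13) + 5)
    (t₂ := m * (5 * n + 12) + 4 * n + 13)
    ((spec_findViolated he1 hσ1).mono le_rfl rfl ?_)).mono (by omega) rfl fun _ h => h
  rintro s₂ ⟨hf2, hm2, h10, -⟩
  have he2 := he1.frame hf2 (by norm_num)
  have hf12 : Frame 9 s s₂ := hf1.trans (hf2.mono (by norm_num))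
  have hσ2 : Holds s₂ 0 σ := fun v => by rw [hm2]; exact hσ1 v
  obtain ⟨τ, hτ, hτ'⟩ := hK
  have hτ2 : Holds s₂ (n + n) τ := fun v => by
    rw [hm2, hm1 _ (by omega)]
    exact hτ v
  have e6 : s₂.reg 6 = s.reg 6 := hf12.1 6 (by norm_num)
  refine (spec_ite (t := m * (5 * n + 12) + 4 * n + 12) (fun hc => ?_) fun hc => ?_).mono
    (by omega) rfl fun _ h => h
  · refine (spec_skip (Q := fun s' => _) ?_).mono (by omega) rfl fun _ h => h
    refine ⟨hf12.mono (by norm_num), hf12.1 7 (by norm_num), ⟨τ, hτ2, by rwa [e6]⟩, e6.le,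
      fun hs => ?_⟩
    rw [Expr.eval, h10, hs] at hc
    exact absurd rfl hc
  · have hs : selected F C σ = none := by
      rw [Expr.eval, h10] at hc
      cases h : selected F C σ with
      | none => rfl
      | some j => rw [h] at hc; simp [code] at hc
    refine (spec_seq (d₁ := 0) (d₂ := 0) (t₁ := m * (5 * n + 12) + 5) (t₂ := 4 * n + 6)
      ((spec_countViolated he2 hσ2).mono le_rfl rfl ?_)).mono (by omega) rfl fun _ h => h
    rintro s₃ ⟨hf3, hm3, h11⟩
    have he3 := he2.frame hf3 (by norm_num)
    have hf13 : Frame 9 s s₃ := hf12.trans (hf3.mono (by norm_num))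
    have hσ3 : Holds s₃ 0 σ := fun v => by rw [hm3]; exact hσ2 v
    have hτ3 : Holds s₃ (n + n) τ := fun v => by rw [hm3]; exact hτ2 v
    have e6' : s₃.reg 6 = s.reg 6 := hf13.1 6 (by norm_num)
    refine (spec_ite (t := 4 * n + 5) (fun hc => ?_) fun hc => ?_).mono
      (by omega) rfl fun _ h => h
    · have hlt : violated F σ < s.reg 6 := by
        simpa [Expr.eval, h11, e6'] using hc
      refine (spec_seq (d₁ := 0) (d₂ := 0) (t₁ := 1) (t₂ := 4 * n + 3) (spec_set ?_)).mono
        (by omega) rfl fun _ h => h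
      have hfs : Frame 6 s₃ (s₃.setReg 6 (s₃.reg 11)) := (Frame.refl 6 s₃).setReg le_rfl
      have he4 : Env F C (s₃.setReg 6 (s₃.reg 11)) := he3.frame hfs (by norm_num)
      refine (spec_copyAll (a := 0) (o := n + n) (σ := σ) he4 (fun s' _ => rfl)
        (fun s' hf => ?_) (by omega) hσ3).mono le_rfl rfl ?_
      · simp only [Expr.eval, (he4.frame hf (by norm_num)).reg0]
      · rintro s₄ ⟨hf4, hσ4, -⟩
        have e64 : s₄.reg 6 = violated F σ := by
          rw [hf4.1 6 (by norm_num)]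
          simp [h11]
        refine ⟨(hf13.mono (by norm_num)).trans (hfs.trans (hf4.mono (by norm_num))), ?_,
          ⟨σ, hσ4, fun _ => ⟨hs, e64.ge⟩⟩, by omega, fun _ => e64.le⟩
        rw [hf4.1 7 (by norm_num)]
        simpa using hf13.1 7 (by norm_num)
    · have hge : s.reg 6 ≤ violated F σ := by
        simpa [Expr.eval, h11, e6'] using hc
      refine (spec_skip (Q := fun s' => _) ?_).mono (by omega) rfl fun _ h => h
      exact ⟨hf13.mono (by norm_num), hf13.1 7 (by norm_num), ⟨τ, hτ3, by rwa [e6']⟩, e6'.le,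
        fun _ => by omega⟩

/-- The best of `A * (n + m + 1) ^ e` trials with as many resampling steps each. -/
def bestProg (A e : ℕ) : Prog :=
  .seq (prelude (.add (.add (.reg 0) (.reg 1)) (.const 1)) A e)
    (.seq (.set 6 (.add (.reg 1) (.const 1)))
      (.seq (forLoop 7 5 attemptProg) (copyAll (.add (.reg 0) (.reg 0)) (.const 0))))

lemma violated_le (σ : Fin n → Bool) : violated F σ ≤ m := by
  unfold violated
  calc _ ≤ ∑ _j : Fin m, 1 := Finset.sum_le_sum fun j _ => by split_ifs <;> omega
    _ = m := by simp

/-- The result is compared with every trial that satisfies the core, so it serves all `γ` and `θ` at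
once. -/
lemma spec_bestProg (A e : ℕ) {N : ℕ} (hN : N = A * (n + m + 1) ^ e) :
    Spec (bestProg A e) (input F C) ω
      (e * (4 * (n + m + 1) + 8) + N * (N * (C.card * (5 * n + 13) + 10 * n + 18) +
        C.card * (5 * n + 13) + m * (5 * n + 12) + 10 * n + 30) + 4 * n + 20)
      (N * ((N + 1) * n))
      fun s' => ∃ τ : Fin n → Bool, Holds s' 0 τ ∧ ∀ r < N,
        selected F C (trial (badValue F) (selected F C) N (drop (r * ((N + 1) * n)) ω)) = none →
        selected F C τ = none ∧ violated F τ ≤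
          violated F (trial (badValue F) (selected F C) N (drop (r * ((N + 1) * n)) ω)) := by
  set b := N * (C.card * (5 * n + 13) + 10 * n + 18) + C.card * (5 * n + 13) +
    m * (5 * n + 12) + 10 * n + 27 with hb
  have hx : (Expr.add (.add (.reg 0) (.reg 1)) (.const 1)).eval (input F C) = n + m + 1 := rfl
  refine (spec_seq (d₁ := 0) (d₂ := N * ((N + 1) * n))
    (t₂ := N * (b + 3) + 4 * n + 10) ((spec_prelude _ A e).mono le_rfl rfl ?_)).mono
    (by rw [hx]; change _ ≤ _ + N * (b + 3) + _ + _; omega) (by omega) fun _ h => h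
  rintro s₁ ⟨hf1, h5, hm1⟩
  rw [hx, ← hN] at h5
  have he1 := (env_input F C).frame hf1 le_rfl
  refine (spec_seq (d₁ := 0) (d₂ := N * ((N + 1) * n)) (t₁ := 1) (t₂ := N * (b + 3) + 4 * n + 7)
    (spec_set ?_)).mono (by omega) (by omega) fun _ h => h
  simp only [Expr.eval, he1.reg1, drop_zero]
  let T : ℕ → Fin n → Bool := fun r =>
    trial (badValue F) (selected F C) N (drop (r * ((N + 1) * n)) ω)
  let I : ℕ → Store → Prop := fun j s' => s'.reg 7 = j ∧ Frame 6 s₁ s' ∧ Kept F C s' ∧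
    ∀ r < j, selected F C (T r) = none → s'.reg 6 ≤ violated F (T r)
  refine (spec_seq (d₁ := N * ((N + 1) * n)) (d₂ := 0) (t₁ := N * (b + 3) + 3)
    (t₂ := 4 * n + 3) ((spec_forLoop (L := N) I (fun j s' h => h.1)
    (fun j s' h => (h.2.1.1 5 (by norm_num)).trans h5) ?_ ?_).mono le_rfl rfl ?_)).mono
    (by omega) (by omega) fun _ h => h
  -- The initial bound `m + 1` exceeds every possible count: nothing is claimed yet of the kept
  -- assignment, and the first trial that satisfies the core is accepted.
  · refine ⟨by simp, ((Frame.refl 6 s₁).setReg le_rfl).setReg (by norm_num),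
      ⟨fun _ => false, fun v => ?_, fun h => ?_⟩, fun r hr => absurd hr (by omega)⟩
    · simp [hm1, input]
    · simp at h
  · rintro j s' hj ⟨h7, hf, hK, hbest⟩
    refine (spec_attemptProg (he1.frame hf (by norm_num)) ((hf.1 5 (by norm_num)).trans h5)
      hK).mono le_rfl rfl ?_
    rintro s'' ⟨hf', h7', hK', h6, hnew⟩
    refine ⟨by simp [h7', h7], (hf.trans hf').setReg (by norm_num), ?_, fun r hr hsel => ?_⟩
    · obtain ⟨τ, hτ, hτ'⟩ := hK'
      exact ⟨τ, hτ, by simpa using hτ'⟩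
    · simp only [setReg_reg, if_neg (show (6 : ℕ) ≠ 7 by norm_num)]
      rcases Nat.lt_succ_iff_lt_or_eq.1 hr with hr | rfl
      · exact h6.trans (hbest r hr hsel)
      · exact hnew hsel
  · rintro s₂ ⟨-, hf2, ⟨τ, hτ, hτ'⟩, hbest⟩
    have he2 := he1.frame hf2 (by norm_num)
    refine (spec_copyAll (a := n + n) (o := 0) he2 (fun s' hf => ?_) (fun s' _ => rfl)
      (by omega) hτ).mono le_rfl rfl ?_
    · simp only [Expr.eval, (he2.frame hf (by norm_num)).reg0]
    · rintro s₃ ⟨-, hτ3, -⟩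
      refine ⟨τ, hτ3, fun r hr hsel => ?_⟩
      have h1 := hbest r hr hsel
      have h2 : violated F (T r) ≤ m := violated_le _
      obtain ⟨h3, h4⟩ := hτ' (by omega)
      exact ⟨h3, h4.trans h1⟩

lemma Holds.assignment_eq {s : Store} {σ : Fin n → Bool} (h : Holds s 0 σ) :
    s.assignment n = σ := by
  funext v
  have := h v
  rw [Nat.zero_add] at this
  unfold Store.assignment
  rw [this]
  cases σ v <;> rfl

end MainPrograms

/-! ### The success probability of one trial -/

section Probability

variable {n m k : ℕ} {F : Formula n m k} {C : Finset (Fin m)}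

lemma violated_eq_violatedOutside {σ : Fin n → Bool} (h : selected F C σ = none) :
    violated F σ = F.violatedOutside C σ := by
  rw [selected_eq_none] at h
  unfold violated Formula.violatedOutside
  rw [Finset.card_filter]
  symm
  refine (Finset.sum_subset (Finset.subset_univ _) fun j _ hj => ?_).trans
    (Finset.sum_congr rfl fun j _ => by split_ifs <;> simp_all)
  rw [Finset.mem_compl, not_not] at hj
  simp [h j hj]

lemma nbhd_subset (j : Fin m) : nbhd (badValue F) C {j} ⊆
    insert j (C.filter fun i => i ≠ j ∧ (F i).SharesVar (F j)) := by
  intro i hi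
  obtain ⟨hiC, j', hj', hadj⟩ := (mem_nbhd _ _).1 hi
  rw [Finset.mem_singleton] at hj'
  subst hj'
  by_cases hij : i = j'
  · simp [hij]
  · refine Finset.mem_insert_of_mem (Finset.mem_filter.2 ⟨hiC, hij, ?_⟩)
    rcases hadj with h | ⟨x, h1, h2⟩
    · exact absurd h.symm hij
    · obtain ⟨a, ha⟩ := isSome_badValue.1 h1
      obtain ⟨b, hb⟩ := isSome_badValue.1 h2
      exact ⟨b, a, hb.trans ha.symm⟩

lemma card_nbhd_le (j : Fin m) : (nbhd (badValue F) C {j}).card ≤ F.coreDegree C j + 1 :=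
  (Finset.card_le_card (nbhd_subset j)).trans (Finset.card_insert_le _ _)

/-- A clause outside the core is not its own neighbour, which saves the `+ 1` of `card_nbhd_le`. -/
lemma card_nbhd_le_of_notMem {j : Fin m} (hj : j ∉ C) :
    (nbhd (badValue F) C {j}).card ≤ F.coreDegree C j := by
  refine Finset.card_le_card fun i hi => ?_
  have hiC : i ∈ C := ((mem_nbhd _ _).1 hi).1
  rcases Finset.mem_insert.1 (nbhd_subset j hi) with rfl | h
  · exact absurd hiC hj
  · exact h

/-- The weight `e 2⁻ᵏ` of a clause. -/
noncomputable def weight (k : ℕ) : ℝ := Real.exp 1 * (1 / 2) ^ k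

lemma weight_pos (k : ℕ) : 0 < weight k := by unfold weight; positivity

lemma weight_mul (k : ℕ) : weight k * (2 ^ k / Real.exp 1) = 1 := by
  unfold weight
  rw [one_div, inv_pow]
  field_simp

lemma one_add_weight_pow_le {N : ℕ} {a : ℝ} (h : weight k * N ≤ a) :
    (1 + weight k) ^ N ≤ Real.exp a := by
  calc (1 + weight k) ^ N ≤ (Real.exp (weight k)) ^ N :=
        pow_le_pow_left₀ (by have := weight_pos k; positivity)
          (by rw [add_comm]; exact Real.add_one_le_exp _) _
    _ = Real.exp (weight k * N) := by rw [← Real.exp_nat_mul, mul_comm]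
    _ ≤ _ := Real.exp_le_exp.2 h

/-- With the clause itself, a neighbourhood has at most `2 ^ k / e = 1 / weight k` members, so the
power is at most `e`. -/
lemma weight_condition
    (hC : ∀ j ∈ C, (F.coreDegree C j : ℝ) ≤ 2 ^ k / Real.exp 1 - 1) :
    ∀ c ∈ C,
    (1 / 2) ^ k * (1 + weight k) ^ (nbhd (badValue F) C {c}).card ≤ weight k := by
  intro c hc
  have h1 : ((nbhd (badValue F) C {c}).card : ℝ) ≤ 2 ^ k / Real.exp 1 := by
    have := hC c hc
    have h2 : ((nbhd (badValue F) C {c}).card : ℝ) ≤ F.coreDegree C c + 1 := by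
      exact_mod_cast card_nbhd_le c
    linarith
  have h2 : weight k * (nbhd (badValue F) C {c}).card ≤ 1 := by
    rw [← weight_mul k]
    exact mul_le_mul_of_nonneg_left h1 (weight_pos k).le
  calc _ ≤ (1 / 2 : ℝ) ^ k * Real.exp 1 :=
        mul_le_mul_of_nonneg_left (one_add_weight_pow_le h2) (by positivity)
    _ = weight k := mul_comm _ _

lemma selected_spec (σ : Fin n → Bool) (c : Fin m) (h : selected F C σ = some c) :
    c ∈ C ∧ Agrees (badValue F c) σ :=
  ⟨(selected_some F C h).1, agrees_badValue.2 (selected_some F C h).2⟩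

lemma mean_alive_le
    (hC : ∀ j ∈ C, (F.coreDegree C j : ℝ) ≤ 2 ^ k / Real.exp 1 - 1) (N : ℕ) :
    N * mean ((N + 1) * n) (fun ω => Set.indicator {σ | selected F C σ ≠ none} 1
      (trial (badValue F) (selected F C) N ω)) ≤ C.card := by
  refine (mean_alive_trial_le card_dom_badValue selected_spec (weight_pos k).le
    (weight_condition hC) N).trans ?_
  rcases C.eq_empty_or_nonempty with rfl | ⟨c, hc⟩
  · simp
  · refine mul_le_of_le_one_right (by positivity) ?_
    -- A nonempty core forces `2 ^ k / e ≥ 1`, since degrees are nonnegative; hence the weight is at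
    -- most `1`.
    have h1 : 1 ≤ (2 : ℝ) ^ k / Real.exp 1 := by
      have := (Nat.cast_nonneg (F.coreDegree C c)).trans (hC c hc)
      linarith
    rw [← weight_mul k]
    exact le_mul_of_one_le_right (weight_pos k).le h1

lemma mean_violatedOutside_le
    (hC : ∀ j ∈ C, (F.coreDegree C j : ℝ) ≤ 2 ^ k / Real.exp 1 - 1)
    {γ : ℝ} (hγ : 0 ≤ γ)
    (hD : ∀ j ∉ C, (F.coreDegree C j : ℝ) ≤ γ * (2 ^ k / Real.exp 1 - 1)) (N : ℕ) :
    mean ((N + 1) * n) (fun ω => (F.violatedOutside C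
      (trial (badValue F) (selected F C) N ω) : ℝ)) ≤
      ((2 : ℝ) ^ k)⁻¹ * Real.exp γ * (Cᶜ.card : ℝ) := by
  have h1 : ∀ σ, (F.violatedOutside C σ : ℝ) =
      ∑ j ∈ Cᶜ, Set.indicator {σ | Agrees (badValue F j) σ} 1 σ := by
    intro σ
    unfold Formula.violatedOutside
    rw [Finset.card_filter]
    push_cast
    refine Finset.sum_congr rfl fun j _ => ?_
    simp only [Set.indicator_apply, Set.mem_ofPred_eq, agrees_badValue, Pi.one_apply]
  simp_rw [h1]
  rw [mean_sum, mul_comm _ (Cᶜ.card : ℝ), ← nsmul_eq_mul]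
  refine Finset.sum_le_card_nsmul _ _ _ fun j hj => ?_
  refine (mean_agrees_trial_le card_dom_badValue selected_spec (weight_pos k).le
    (weight_condition hC) j N).trans ?_
  have h2 : ((nbhd (badValue F) C {j}).card : ℝ) ≤ γ * (2 ^ k / Real.exp 1 - 1) :=
    le_trans (by exact_mod_cast card_nbhd_le_of_notMem (Finset.mem_compl.1 hj))
      (hD j (Finset.mem_compl.1 hj))
  have h3 : weight k * (nbhd (badValue F) C {j}).card ≤ γ := by
    calc _ ≤ weight k * (γ * (2 ^ k / Real.exp 1 - 1)) :=
          mul_le_mul_of_nonneg_left h2 (weight_pos k).le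
      _ = γ * (weight k * (2 ^ k / Real.exp 1) - weight k) := by ring
      _ ≤ γ * 1 := by
          rw [weight_mul]
          exact mul_le_mul_of_nonneg_left (by linarith [weight_pos k]) hγ
      _ = γ := mul_one γ
  rw [one_div, inv_pow]
  exact mul_le_mul_of_nonneg_left (one_add_weight_pow_le h3) (by positivity)

/-- The assignment satisfies the core and violates at most `a` of the other clauses. -/
def Good (F : Formula n m k) (C : Finset (Fin m)) (a : ℝ) : Set (Fin n → Bool) :=
  {σ | selected F C σ = none ∧ (F.violatedOutside C σ : ℝ) ≤ a}

/-- Markov's inequality for the violated outside clauses, plus the probability that the core is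
still violated after `N` steps. -/
lemma mean_not_good_le
    (hC : ∀ j ∈ C, (F.coreDegree C j : ℝ) ≤ 2 ^ k / Real.exp 1 - 1)
    {γ a : ℝ} (hγ : 0 ≤ γ) (ha : 0 < a)
    (hD : ∀ j ∉ C, (F.coreDegree C j : ℝ) ≤ γ * (2 ^ k / Real.exp 1 - 1)) {N : ℕ}
    (hN : 0 < N) :
    mean ((N + 1) * n) (fun ω => Set.indicator
      (Good F C (a * ((2 : ℝ) ^ k)⁻¹ * Real.exp γ * (Cᶜ.card : ℝ)))ᶜ 1
      (trial (badValue F) (selected F C) N ω)) ≤ 1 / a + C.card / N := by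
  set μ := ((2 : ℝ) ^ k)⁻¹ * Real.exp γ * (Cᶜ.card : ℝ) with hμ
  have hμ0 : 0 ≤ μ := by positivity
  have hrw : a * ((2 : ℝ) ^ k)⁻¹ * Real.exp γ * (Cᶜ.card : ℝ) = a * μ := by rw [hμ]; ring
  rw [hrw]
  have hpt : ∀ σ, Set.indicator (Good F C (a * μ))ᶜ (1 : (Fin n → Bool) → ℝ) σ ≤
      (a * μ)⁻¹ * F.violatedOutside C σ + Set.indicator {σ | selected F C σ ≠ none} 1 σ := by
    intro σ
    have hX : (0 : ℝ) ≤ (a * μ)⁻¹ * F.violatedOutside C σ := by positivity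
    have hI : (0 : ℝ) ≤ Set.indicator {σ | selected F C σ ≠ none} 1 σ :=
      Set.indicator_nonneg (fun _ _ => zero_le_one) _
    by_cases hg : σ ∈ Good F C (a * μ)
    · rw [Set.indicator_of_notMem (by simpa using hg)]
      linarith
    · rw [Set.indicator_of_mem (by simpa using hg), Pi.one_apply]
      by_cases hs : selected F C σ = none
      · have hlt : a * μ < F.violatedOutside C σ := by
          by_contra hle
          exact hg ⟨hs, not_lt.1 hle⟩
        -- If `μ = 0` there are no outside clauses, and none can be violated.
        have hμpos : 0 < μ := by
          rcases hμ0.lt_or_eq with h | h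
          · exact h
          · exfalso
            have hc : (Cᶜ.card : ℝ) = 0 := by
              rw [hμ] at h
              rcases mul_eq_zero.1 h.symm with h | h
              · exact absurd h (by positivity)
              · exact h
            have h0 : F.violatedOutside C σ = 0 := by
              refine Nat.le_zero.1 ((Finset.card_filter_le _ _).trans ?_)
              exact_mod_cast hc.le
            rw [h0, ← h] at hlt
            simp at hlt
        have : 1 ≤ (a * μ)⁻¹ * F.violatedOutside C σ := by
          rw [inv_mul_eq_div, le_div_iff₀ (mul_pos ha hμpos), one_mul]
          exact hlt.le
        linarith
      · rw [Set.indicator_of_mem (show σ ∈ {σ | selected F C σ ≠ none} from hs), Pi.one_apply]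
        linarith
  refine (mean_mono _ fun ω => hpt _).trans ?_
  rw [mean_add, mean_const_mul]
  refine add_le_add ?_ ?_
  · refine (mul_le_mul_of_nonneg_left (mean_violatedOutside_le hC hγ hD N)
      (by positivity)).trans ?_
    rw [← hμ, mul_inv, mul_assoc, one_div]
    exact mul_le_of_le_one_right (by positivity) inv_mul_le_one
  · rw [le_div_iff₀ (by positivity), mul_comm]
    exact mean_alive_le hC N

end Probability

/-- The coefficients are natural numbers with sum `q.eval 1`, so a program that computes only
constant multiples of powers can dominate `q`. -/
lemma eval_add_one_le (q : Polynomial ℕ) (x : ℕ) :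
    q.eval x + 1 ≤ (q.eval 1 + 1) * (x + 1) ^ q.natDegree := by
  have h1 : q.eval x ≤ q.eval 1 * (x + 1) ^ q.natDegree := by
    rw [Polynomial.eval_eq_sum_range, Polynomial.eval_eq_sum_range, Finset.sum_mul]
    refine Finset.sum_le_sum fun i hi => ?_
    rw [one_pow, mul_one]
    refine Nat.mul_le_mul_left _ ((Nat.pow_le_pow_left (Nat.le_succ x) i).trans ?_)
    exact Nat.pow_le_pow_right (Nat.succ_pos x) (Nat.lt_succ_iff.1 (Finset.mem_range.1 hi))
  have h2 : 1 ≤ (x + 1) ^ q.natDegree := Nat.one_le_pow _ _ (Nat.succ_pos x)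
  rw [add_mul, one_mul]
  exact add_le_add h1 h2

/-! ### From good trials to good outputs -/

section Success

variable {n m k : ℕ} {F : Formula n m k} {C : Finset (Fin m)}

lemma satisfied_of_mem_good {a : ℝ} {σ : Fin n → Bool} (h : σ ∈ Good F C a) :
    (∀ j ∈ C, (F j).Satisfied σ) ∧ (F.violatedOutside C σ : ℝ) ≤ a :=
  ⟨(selected_eq_none F C).1 h.1, h.2⟩

lemma haltsWithin_of_spec {P : Prog} {s : Store} {t T d : ℕ}
    {Q : (ℕ → Bool) → Store → Prop} (h : ∀ ω, Spec P s ω t d (Q ω)) (hT : t ≤ T) :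
    HaltsWithin P s T := by
  intro ω
  obtain ⟨s', -, h⟩ := (h ω).run_eq
  rw [h T hT]

lemma good_output_of_spec {P : Prog} {t T d : ℕ} {Q : (ℕ → Bool) → (Fin n → Bool) → Prop}
    (h : ∀ ω, Spec P (input F C) ω t d fun s' => ∃ τ, Holds s' 0 τ ∧ Q ω τ) (hT : t ≤ T)
    (ω : ℕ → Bool) : Q ω (output P F C T ω) := by
  obtain ⟨s', ⟨τ, hτ, hQ⟩, h⟩ := (h ω).run_eq
  rw [output, h T hT, hτ.assignment_eq]
  exact hQ

lemma mem_good_of_le {a : ℝ} {σ τ : Fin n → Bool} (hσ : σ ∈ Good F C a)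
    (hτ : selected F C τ = none) (h : violated F τ ≤ violated F σ) : τ ∈ Good F C a := by
  rw [violated_eq_violatedOutside hτ, violated_eq_violatedOutside hσ.1] at h
  exact ⟨hτ, le_trans (by exact_mod_cast h) hσ.2⟩

/-- The probability that one trial is good. -/
lemma le_coinMeasure_trial (S : Set (Fin n → Bool)) {N : ℕ} {b : ℝ}
    (h : mean ((N + 1) * n) (fun ω => Sᶜ.indicator 1 (trial (badValue F) (selected F C) N ω)) ≤
      b) :
    1 - b ≤ coinMeasure.real {ω | trial (badValue F) (selected F C) N ω ∈ S} := by
  have hdep : DependsOnFirst ((N + 1) * n)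
      {ω | trial (badValue F) (selected F C) N ω ∈ S} := by
    intro ω ω' hω
    change trial _ _ N ω ∈ S ↔ trial _ _ N ω' ∈ S
    rw [trial_congr _ _ hω]
  rw [coinMeasure_eq_mean hdep, mean_indicator_compl]
  have : mean ((N + 1) * n) (Set.indicator
      {ω | trial (badValue F) (selected F C) N ω ∈ S}ᶜ 1) ≤ b := h
  linarith

/-- The probability that one of `R` independent trials is good. -/
lemma le_coinMeasure_exists_trial (S : Set (Fin n → Bool)) {N : ℕ} (R : ℕ) {b : ℝ}
    (h : mean ((N + 1) * n) (fun ω => Sᶜ.indicator 1 (trial (badValue F) (selected F C) N ω)) ≤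
      b) :
    1 - b ^ R ≤ coinMeasure.real {ω | ∃ r < R,
      trial (badValue F) (selected F C) N (drop (r * ((N + 1) * n)) ω) ∈ S} := by
  set d := (N + 1) * n with hd
  set A : Set (ℕ → Bool) := {ω | ∃ r < R,
      trial (badValue F) (selected F C) N (drop (r * d) ω) ∈ S} with hA
  have hdep : DependsOnFirst (R * d) A := by
    intro ω ω' hω
    refine exists_congr fun r => and_congr_right fun hr => ?_
    rw [trial_congr _ _ fun i hi => ?_]
    refine hω _ ?_
    have h1 : (r + 1) * d ≤ R * d := Nat.mul_le_mul_right d hr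
    rw [Nat.succ_mul] at h1
    omega
  rw [coinMeasure_eq_mean hdep, mean_indicator_compl]
  let g : (ℕ → Bool) → ℝ := fun ω => Sᶜ.indicator 1 (trial (badValue F) (selected F C) N ω)
  have hg0 : ∀ ω, 0 ≤ g ω := fun ω => Set.indicator_nonneg (fun _ _ => zero_le_one) _
  have hpt : ∀ ω, Aᶜ.indicator (1 : (ℕ → Bool) → ℝ) ω ≤
      ∏ r ∈ Finset.range R, g (drop (r * d) ω) := by
    intro ω
    by_cases hω : ω ∈ A
    · rw [Set.indicator_of_notMem (by simpa using hω)]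
      exact Finset.prod_nonneg fun r _ => hg0 _
    · rw [Set.indicator_of_mem (by simpa using hω), Pi.one_apply]
      refine (Finset.prod_eq_one fun r hr => ?_).ge
      have : trial (badValue F) (selected F C) N (drop (r * d) ω) ∈ Sᶜ :=
        fun hmem => hω ⟨r, Finset.mem_range.1 hr, hmem⟩
      exact Set.indicator_of_mem this _
  have h1 := mean_mono (R * d) hpt
  rw [mean_prod_drop (g := g) fun ω ω' hω => by
    simp only [g]
    rw [trial_congr _ _ hω]] at h1
  have h2 : mean d g ^ R ≤ b ^ R :=
    pow_le_pow_left₀ (by simpa [mean_const] using mean_mono d hg0) h R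
  have h3 : mean (R * d) (Aᶜ.indicator 1) ≤ mean d g ^ R := h1
  linarith

end Success

/-- Amplification by independent repetition. -/
lemma one_sub_pow_le {x Q c s N : ℕ} (hs : 0 < s) (hx : x ≤ s) (hQ : 0 < Q) {θ : ℝ}
    (hθ : 1 ≤ θ * Q) (hθ0 : 0 < θ) (hN : 2 * (c + 1) * (Q + 1) * s ≤ N) :
    (1 / (1 + θ) + x / N : ℝ) ^ N ≤ 1 / (s : ℝ) ^ c := by
  have hQ' : (0 : ℝ) < Q := by exact_mod_cast hQ
  have hs' : (0 : ℝ) < s := by exact_mod_cast hs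
  have hN' : 2 * ((c : ℝ) + 1) * (Q + 1) * s ≤ N := by exact_mod_cast hN
  have hN0 : (0 : ℝ) < N := lt_of_lt_of_le (by positivity) hN'
  have hx' : (x : ℝ) ≤ s := by exact_mod_cast hx
  have h1 : 1 / (1 + θ) ≤ 1 - 1 / ((Q : ℝ) + 1) := by
    have e : 1 - 1 / ((Q : ℝ) + 1) = Q / (Q + 1) := by field_simp; ring
    rw [e, div_le_div_iff₀ (by positivity) (by positivity)]
    nlinarith
  have h2 : (x : ℝ) / N ≤ 1 / (2 * (Q + 1)) := by
    rw [div_le_div_iff₀ hN0 (by positivity), one_mul]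
    calc (x : ℝ) * (2 * (Q + 1)) ≤ s * (2 * (Q + 1)) :=
          mul_le_mul_of_nonneg_right hx' (by positivity)
      _ ≤ 2 * ((c : ℝ) + 1) * (Q + 1) * s := by
          have : (0 : ℝ) ≤ c * (2 * (Q + 1) * s) := by positivity
          linarith
      _ ≤ N := hN'
  -- Unfinished runs use up at most half of the margin `1 / (Q + 1)` that Markov's inequality
  -- leaves.
  have h3 : (1 / (1 + θ) + x / N : ℝ) ≤ Real.exp (-(1 / (2 * (Q + 1)))) := by
    have e : 1 / ((Q : ℝ) + 1) = 2 * (1 / (2 * (Q + 1))) := by field_simp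
    have := Real.add_one_le_exp (-(1 / (2 * ((Q : ℝ) + 1))))
    linarith
  calc (1 / (1 + θ) + x / N : ℝ) ^ N ≤ Real.exp (-(1 / (2 * (Q + 1)))) ^ N :=
        pow_le_pow_left₀ (by positivity) h3 _
    _ = Real.exp (-(N / (2 * (Q + 1)))) := by rw [← Real.exp_nat_mul]; congr 1; ring
    _ ≤ Real.exp (-(c * s)) := by
        refine Real.exp_le_exp.2 (neg_le_neg ?_)
        rw [le_div_iff₀ (by positivity)]
        refine le_trans ?_ hN'
        have : (0 : ℝ) ≤ 2 * (Q + 1) * s := by positivity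
        linarith
    _ = 1 / Real.exp s ^ c := by rw [Real.exp_neg, ← Real.exp_nat_mul, one_div]
    _ ≤ 1 / (s : ℝ) ^ c := by
        refine one_div_le_one_div_of_le (by positivity) (pow_le_pow_left₀ hs'.le ?_ c)
        linarith [Real.add_one_le_exp (s : ℝ)]

open Polynomial in
/-- A bound for the running time of `singleProg`. -/
noncomputable def singleTime (e : ℕ) : Polynomial ℕ :=
  C e * (4 * (X + 1) + 8) + (X + 1) ^ e * (X * (5 * X + 13) + 10 * X + 18) + 6 * X + 13

open Polynomial in
/-- A bound for the running time of `bestProg`. -/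
noncomputable def bestTime (A e : ℕ) : Polynomial ℕ :=
  C e * (4 * (X + 1) + 8) + C A * (X + 1) ^ e * (C A * (X + 1) ^ e *
    (X * (5 * X + 13) + 10 * X + 18) + X * (5 * X + 13) + X * (5 * X + 12) + 10 * X + 30) +
    4 * X + 20

lemma le_singleTime (e n b : ℕ) :
    e * (4 * (n + b + 1) + 8) + (n + b + 1) ^ e * (b * (5 * n + 13) + 10 * n + 18) + 6 * n + 13 ≤
      (singleTime e).eval (n + b) := by
  have hn : n ≤ n + b := Nat.le_add_right n b
  have hb : b ≤ n + b := Nat.le_add_left b n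
  simp only [singleTime, Polynomial.eval_add, Polynomial.eval_mul, Polynomial.eval_C,
    Polynomial.eval_ofNat, Polynomial.eval_X, Polynomial.eval_one, Polynomial.eval_pow]
  gcongr

lemma le_bestTime (A e n m b : ℕ) (hb : b ≤ m) :
    e * (4 * (n + m + 1) + 8) + A * (n + m + 1) ^ e * (A * (n + m + 1) ^ e *
      (b * (5 * n + 13) + 10 * n + 18) + b * (5 * n + 13) + m * (5 * n + 12) + 10 * n + 30) +
      4 * n + 20 ≤ (bestTime A e).eval (n + m) := by
  have hn : n ≤ n + m := Nat.le_add_right n m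
  have hm : m ≤ n + m := Nat.le_add_left m n
  have hb' : b ≤ n + m := hb.trans hm
  simp only [bestTime, Polynomial.eval_add, Polynomial.eval_mul, Polynomial.eval_C,
    Polynomial.eval_ofNat, Polynomial.eval_X, Polynomial.eval_one, Polynomial.eval_pow]
  gcongr

end RandRAM

theorem lemma7p1 :
    -- the approximation factor `1 + θ`, for every `θ ≥ 1 / q(n + m)`, with high probability
    (∀ (q : Polynomial ℕ) (c : ℕ), ∃ (P : RandRAM.Prog) (p : Polynomial ℕ),
      ∀ (n m k : ℕ) (F : Formula n m k) (C : Finset (Fin m)),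
        RandRAM.HaltsWithin P (RandRAM.input F C) (p.eval (n + m)) ∧
        ∀ γ θ : ℝ, 0 ≤ γ → 0 < θ → 1 ≤ θ * (q.eval (n + m) : ℕ) →
          (∀ j ∈ C, (F.coreDegree C j : ℝ) ≤ 2 ^ k / Real.exp 1 - 1) →
          (∀ j ∉ C, (F.coreDegree C j : ℝ) ≤ γ * (2 ^ k / Real.exp 1 - 1)) →
          1 - 1 / ((n : ℝ) + m + 1) ^ c ≤
            RandRAM.coinMeasure.real {ω |
              let σ := RandRAM.output P F C (p.eval (n + m)) ω
              (∀ j ∈ C, (F j).Satisfied σ) ∧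
              (F.violatedOutside C σ : ℝ) ≤
                (1 + θ) * ((2 : ℝ) ^ k)⁻¹ * Real.exp γ * (Cᶜ.card : ℝ)}) ∧
    -- the factor `1 / ρ` with constant probability, in time polynomial in `n` and `|C|` only
    (∀ c : ℕ, ∃ (P : RandRAM.Prog) (p : Polynomial ℕ),
      ∀ (n m k : ℕ) (F : Formula n m k) (C : Finset (Fin m)),
        RandRAM.HaltsWithin P (RandRAM.input F C) (p.eval (n + C.card)) ∧
        ∀ γ ρ : ℝ, 0 ≤ γ → 0 < ρ →
          (∀ j ∈ C, (F.coreDegree C j : ℝ) ≤ 2 ^ k / Real.exp 1 - 1) →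
          (∀ j ∉ C, (F.coreDegree C j : ℝ) ≤ γ * (2 ^ k / Real.exp 1 - 1)) →
          1 - ρ - 1 / ((n : ℝ) + C.card + 1) ^ c ≤
            RandRAM.coinMeasure.real {ω |
              let σ := RandRAM.output P F C (p.eval (n + C.card)) ω
              (∀ j ∈ C, (F j).Satisfied σ) ∧
              (F.violatedOutside C σ : ℝ) ≤
                (1 / ρ) * ((2 : ℝ) ^ k)⁻¹ * Real.exp γ * (Cᶜ.card : ℝ)}) := by
  open RandRAM Coins MoserTardos in
  constructor
  · intro q c
    -- Chosen so that `A * (n + m + 1) ^ e` is at least `2 (c + 1) (q(n + m) + 1) (n + m + 1)`, as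
    -- `one_sub_pow_le` requires; the extra power in `e` supplies the last factor.
    set A := 2 * (c + 1) * (q.eval 1 + 1) with hA
    set e := q.natDegree + 1 with he
    refine ⟨bestProg A e, bestTime A e, fun n m k F C => ?_⟩
    have hCm : C.card ≤ m := by simpa using Finset.card_le_univ C
    have hT := le_bestTime A e n m C.card hCm
    have hspec := fun ω => spec_bestProg (F := F) (C := C) (ω := ω) A e rfl
    refine ⟨haltsWithin_of_spec hspec hT, fun γ θ hγ hθ hθq hC hD => ?_⟩
    set N := A * (n + m + 1) ^ e with hN
    have hQ : 0 < q.eval (n + m) := by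
      rcases Nat.eq_zero_or_pos (q.eval (n + m)) with h | h
      · rw [h] at hθq; norm_num at hθq
      · exact h
    have hNle : 2 * (c + 1) * (q.eval (n + m) + 1) * (n + m + 1) ≤ N := by
      rw [hN, hA, he, pow_succ, ← mul_assoc, mul_assoc (2 * (c + 1)) (q.eval 1 + 1)]
      gcongr
      exact eval_add_one_le q (n + m)
    have hN0 : 0 < N := lt_of_lt_of_le (by positivity) hNle
    have hbad := mean_not_good_le hC hγ (show 0 < 1 + θ by linarith) hD hN0
    have hpow := one_sub_pow_le (Nat.succ_pos (n + m))
      (show C.card ≤ n + m + 1 by omega) hQ hθq hθ hNle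
    have hprob := le_coinMeasure_exists_trial _ N hbad
    refine le_trans ?_ (hprob.trans (measureReal_mono ?_ (by finiteness)))
    · push_cast at hpow
      linarith
    · rintro ω ⟨r, hr, hgood⟩
      obtain ⟨h1, h2⟩ := good_output_of_spec hspec hT ω r hr hgood.1
      exact satisfied_of_mem_good (mem_good_of_le hgood h1 h2)
  · intro c
    -- One power more than `c` absorbs the numerator of the bound `|C| / N` for unfinished runs.
    refine ⟨singleProg (c + 1), singleTime (c + 1), fun n m k F C => ?_⟩
    have hT := le_singleTime (c + 1) n C.card
    have hspec := fun ω => spec_singleProg (F := F) (C := C) (ω := ω) (c + 1)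
    refine ⟨haltsWithin_of_spec hspec hT, fun γ ρ hγ hρ hC hD => ?_⟩
    set N := (n + C.card + 1) ^ (c + 1) with hN
    have hN0 : 0 < N := by positivity
    have hbad := mean_not_good_le hC hγ (show 0 < 1 / ρ by positivity) hD hN0
    refine le_trans ?_ ((le_coinMeasure_trial _ hbad).trans
      (measureReal_mono (fun ω hω => ?_) (by finiteness)))
    · have h1 : (C.card : ℝ) / N ≤ 1 / ((n : ℝ) + C.card + 1) ^ c := by
        rw [div_le_div_iff₀ (by positivity) (by positivity), hN]
        push_cast
        rw [pow_succ, one_mul, mul_comm]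
        refine mul_le_mul_of_nonneg_left ?_ (by positivity)
        linarith [Nat.cast_nonneg (α := ℝ) n]
      rw [one_div_one_div]
      linarith
    · have h1 := good_output_of_spec (Q := fun ω τ => τ = trial (badValue F) (selected F C) N ω)
        (fun ω => (hspec ω).mono le_rfl rfl fun s' h => ⟨_, h, rfl⟩) hT ω
      refine satisfied_of_mem_good ?_
      rw [h1]
      exact hω
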